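/- Let $(k,\sigma)$ be a computable difference field of characteristic $0$: $k$ is a field of characteristic $0$, $\sigma$ is a field automorphism of $k$, the elements of $k$ are represented effectively, and equality, the field operations and $\sigma$ are computable. Let $C=\mathrm{Const}_\sigma(k)=\{c\in k:\sigma(c)=c\}$, and suppose that one can compute the set of non-negative integer roots of any given nonzero polynomial with coefficients in $C$. Let $t$ be a $\Sigma^*$-monomial over $k$; that is, $t$ is an element of a difference field extension of $(k,\sigma)$ (whose automorphism is again denoted by $\sigma$), $t$ is transcendental over $k$, $\sigma(t)-t\in k$ and $\mathrm{Const}_\sigma(k(t))=\mathrm{Const}_\sigma(k)$. Suppose that one can solve parameterized linear difference equations with coefficients in $k$: there is an algorithm that, given any $\ell,m\in\mathbb N$, $0\ne(a_0,\dots,a_\ell)\in k^{\ell+1}$ and $(b_1,\dots,b_m)\in k^m$, computes a basis of the $C$-vector space of all $(g,c_1,\dots,c_m)\in k\times C^m$ with $$a_\ell\,\sigma^\ell(g)+\dots+a_1\,\sigma(g)+a_0\,g=c_1b_1+\dots+c_mb_m .$$ Then one can bound the degree of solutions in $k[t]$ of parameterized linear difference equations with coefficients in $k[t]$: there is an algorithm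 that, given any $\ell,m\in\mathbb N$, $0\neq(a_0,\dots,a_\ell)\in k[t]^{\ell+1}$ and $(\Phi_1,\dots,\Phi_m)\in k[t]^m$, computes a $d\in\mathbb N$ such that $\deg y\le d$ for all $y\in k[t]$ and $c_1,\dots,c_m\in C$ with $$a_\ell\,\sigma^\ell(y)+\dots+a_1\,\sigma(y)+a_0\,y=c_1\Phi_1+\dots+c_m\Phi_m .$$ -/

import Mathlib

open Polynomial

noncomputable section

/-- The constant field `Const_σ(k) = {c ∈ k : σ(c) = c}` of a difference field `(k, σ)`. -/
def constField {k : Type*} [Field k] (σ : k ≃+* k) : Subfield k :=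
  (σ : k →+* k).eqLocusField (RingHom.id k)

/-- The action `a₀ g + a₁ σ(g) + ⋯ + a_ℓ σ^ℓ(g)` on `g` of the difference operator
`a₀ E⁰ + a₁ E¹ + ⋯ + a_ℓ E^ℓ`, the coefficients being listed as `[a₀, …, a_ℓ]`. -/
def applyOperator {R : Type*} [CommRing R] (σ : R ≃+* R) (a : List R) (g : R) : R :=
  ∑ i : Fin a.length, a.get i * (⇑σ)^[(i : ℕ)] g

/-- `(K, τ)` is a difference field extension of `(k, σ)`. -/
def IsDifferenceExtension {k K : Type*} [Field k] [Field K] [Algebra k K]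
    (σ : k ≃+* k) (τ : K ≃+* K) : Prop :=
  ∀ x : k, τ (algebraMap k K x) = algebraMap k K (σ x)

/-- `t` is a unimonomial over `k`: it is transcendental over `k` and `τ(t) = α t + β` with
`α ∈ k^*`, `β ∈ k`. -/
def IsUnimonomial (k : Type*) {K : Type*} [Field k] [Field K] [Algebra k K]
    (τ : K ≃+* K) (t : K) : Prop :=
  Transcendental k t ∧
    ∃ α β : k, α ≠ 0 ∧ τ t = algebraMap k K α * t + algebraMap k K β

/-- `t` is a `Σ^*`-monomial over `(k, σ)`: a unimonomial over `k` with
`Const(k(t)) = Const(k)` and `τ(t) - t ∈ k`. -/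
structure IsSigmaStarMonomial {k K : Type*} [Field k] [Field K] [Algebra k K]
    (σ : k ≃+* k) (τ : K ≃+* K) (t : K) : Prop where
  unimonomial : IsUnimonomial k τ t
  constants : (IntermediateField.adjoin k {t} : Set K) ∩ (constField τ : Set K) =
    algebraMap k K '' (constField σ : Set k)
  shift : ∃ η : k, τ t - t = algebraMap k K η

/-- The elements of `k` are represented effectively (by the codes of the instance
`Primcodable k`, which are unique, so that equality is decidable), and the field operations
and `σ` are computable on them. -/
structure IsComputableDifferenceField {k : Type*} [Field k] [Primcodable k]
    (σ : k ≃+* k) : Prop where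
  add : Computable₂ (fun x y : k => x + y)
  mul : Computable₂ (fun x y : k => x * y)
  neg : Computable (fun x : k => -x)
  inv : Computable (fun x : k => x⁻¹)
  sigma : Computable (fun x : k => σ x)

/-- The solution space `V(a, b, k)`: all `(g, c₁, …, c_m)` with `g ∈ k` and
`c₁, …, c_m ∈ Const_σ(k)` such that
`a_ℓ σ^ℓ(g) + ⋯ + a₁ σ(g) + a₀ g = c₁ b₁ + ⋯ + c_m b_m`. -/
def pldeSpace {k : Type*} [Field k] (σ : k ≃+* k) (a b : List k) :
    Submodule (constField σ) (k × (Fin b.length → k)) where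
  carrier := {p | (∀ j, p.2 j ∈ constField σ) ∧
    applyOperator σ a p.1 = ∑ j : Fin b.length, p.2 j * b.get j}
  zero_mem' := by
    refine ⟨fun j => (constField σ).zero_mem, ?_⟩
    simp [applyOperator, iterate_map_zero]
  add_mem' := by
    rintro p q ⟨hp, hp'⟩ ⟨hq, hq'⟩
    refine ⟨fun j => (constField σ).add_mem (hp j) (hq j), ?_⟩
    have h : applyOperator σ a (p.1 + q.1) =
        applyOperator σ a p.1 + applyOperator σ a q.1 := by
      simp [applyOperator, iterate_map_add, mul_add, Finset.sum_add_distrib]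
    simp only [Prod.fst_add, Prod.snd_add, Pi.add_apply, add_mul, Finset.sum_add_distrib]
    rw [h, hp', hq']
  smul_mem' := by
    rintro c p ⟨hp, hp'⟩
    refine ⟨fun j => (constField σ).mul_mem c.2 (hp j), ?_⟩
    have hc : ∀ n : ℕ, (⇑σ)^[n] (c : k) = c := fun n =>
      Function.iterate_fixed (c.2 : σ (c : k) = c) n
    have h : applyOperator σ a ((c : k) * p.1) = (c : k) * applyOperator σ a p.1 := by
      simp only [applyOperator, iterate_map_mul, hc, Finset.mul_sum]
      exact Finset.sum_congr rfl fun i _ => by ring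
    change applyOperator σ a ((c : k) * p.1) =
      ∑ j : Fin b.length, ((c : k) * p.2 j) * b.get j
    rw [h, hp', Finset.mul_sum]
    exact Finset.sum_congr rfl fun i _ => by ring

/-- The vector `(w, d₁, …, d_m) ∈ k × k^m` given by the pair `(w, [d₁, …, d_m])`. -/
def toVector {k : Type*} [Field k] (m : ℕ) (p : k × List k) : k × (Fin m → k) :=
  (p.1, fun j => p.2.getD j 0)

/-- One can compute all solutions of parameterized linear difference equations with
coefficients in `k`: there is an algorithm that maps any `0 ≠ a ∈ k^(ℓ+1)` and `b ∈ k^m`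
(for all `ℓ`, `m`) to a basis of the `Const_σ(k)`-vector space `V(a, b, k)`. -/
def CanSolvePLDE {k : Type*} [Field k] [Primcodable k] (σ : k ≃+* k) : Prop :=
  ∃ solve : List k × List k → List (k × List k), Computable solve ∧
    ∀ a b : List k, (∃ x ∈ a, x ≠ 0) →
      LinearIndependent (constField σ)
        (fun i : Fin (solve (a, b)).length => toVector b.length ((solve (a, b)).get i)) ∧
      Submodule.span (constField σ)
        (Set.range fun i : Fin (solve (a, b)).length =>
          toVector b.length ((solve (a, b)).get i)) = pldeSpace σ a b

/-- The polynomial `p₀ + p₁ X + ⋯ + p_d X^d` given by the list `[p₀, …, p_d]`. -/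
def polyOfList {k : Type*} [Field k] (p : List k) : k[X] :=
  ∑ i : Fin p.length, monomial (i : ℕ) (p.get i)

/-- One can compute the set of nonnegative integer roots of any nonzero polynomial with
coefficients in `Const_σ(k)`. -/
def CanComputeNatRoots {k : Type*} [Field k] [Primcodable k] (σ : k ≃+* k) : Prop :=
  ∃ roots : List k → List ℕ, Computable roots ∧
    ∀ p : List k, (∀ c ∈ p, c ∈ constField σ) → polyOfList p ≠ 0 →
      ∀ n : ℕ, n ∈ roots p ↔ (polyOfList p).eval (n : k) = 0

/-- One can bound the degree of the solutions in `k[t]` of parameterized linear difference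
equations with coefficients in `k[t]`: there is an algorithm that maps any
`0 ≠ a ∈ k[t]^(ℓ+1)` and `Φ ∈ k[t]^m` (for all `ℓ`, `m`; polynomials in `t` are given by their
coefficient lists) to some `d ∈ ℕ` such that `deg y ≤ d` for all `y ∈ k[t]` and
`c₁, …, c_m ∈ Const_σ(k)` with
`a_ℓ τ^ℓ(y) + ⋯ + a₁ τ(y) + a₀ y = c₁ Φ₁ + ⋯ + c_m Φ_m`. -/
def CanBoundPLDEDegree {k K : Type*} [Field k] [Primcodable k] [Field K] [Algebra k K]
    (σ : k ≃+* k) (τ : K ≃+* K) (t : K) : Prop :=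
  ∃ bound : List (List k) × List (List k) → ℕ, Computable bound ∧
    ∀ a Φ : List (List k), (∃ p ∈ a, polyOfList p ≠ 0) →
      ∀ (y : k[X]) (c : Fin Φ.length → constField σ),
        applyOperator τ (a.map fun p => aeval t (polyOfList p)) (aeval t y) =
            ∑ j : Fin Φ.length,
              algebraMap k K (c j : k) * aeval t (polyOfList (Φ.get j)) →
          y.degree ≤ (bound (a, Φ) : WithBot ℕ)

end

/-! Let `j` be the length of the list of coefficients, `N` their largest degree, and `y` a
polynomial of degree `x + j` with coefficient `z_i` at `t^(x+j-i)`. If `deg y` is large compared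
with the degrees of the right-hand sides, then the coefficients of the image of `y` at
`t^(x+j+N-r)`, `r ≤ j`, all vanish; `coeff_polyOperator` expands them. Row `r` says that the
operator over `k` formed by the coefficients of `t^N` maps `z_r` to an expression in the earlier
`z_i`. Solving equations over `k` therefore confines `z_r` to the span, over the constants, of a
finite list that does not depend on `x` (`mem_span_candidates`). What remains is a homogeneous
linear system for constants `c_{i,q}` whose entries are polynomials in `x`. As the unknowns are
constants, each `σ^e` may be applied to each row.

A certificate writes, for a nonzero polynomial `p` with constant coefficients, every `p * e_{0,q}`
as a combination over `k[x]` of these transformed rows. It forces `z_0 = 0` unless `p(x) = 0`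
(`IsCertificate.eval_eq_zero`), so the natural roots of `p` bound `x`. Certificates can be checked,
hence found by unbounded search, provided that one exists.

For existence, suppose that no nonzero multiple of some `e_{0,q}` lies in the row module. Since
`k[x]` is a principal ideal domain, a linear functional then yields solutions of the system over `k`
for almost all `x`. These descend to constant solutions (`exists_fixed_mem`), that is, to
approximate solutions of all large degrees. This is impossible: `η` is not of the form `σ(g) - g`,
so the difference operator on `k(t)` lowers a nonzero degree by at most one. By reduction of order,
an operator of order `n` then cannot lower the degrees of all of `n + 1` elements with well
separated degrees by more than `n`, measured against the degree of its coefficients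
(`IsDifferenceDegree.exists_le_map_operator`). Finally `p` can be taken constant because the row
module is stable under `σ`. -/

/-! ### Closure properties of computable functions. -/

namespace Computable

variable {α β γ : Type*} [Primcodable α] [Primcodable β] [Primcodable γ]

theorem list_getD {l : α → List β} {n : α → ℕ} (d : β) (hl : Computable l) (hn : Computable n) :
    Computable fun a => (l a).getD (n a) d :=
  (option_getD (list_getElem?.comp hl hn) (const d)).of_eq fun p => by
    simp [List.getD_eq_getElem?_getD]

theorem list_map_range {n : α → ℕ} {f : α → ℕ → β} (hn : Computable n)
    (hf : Computable fun p : α × ℕ => f p.1 p.2) :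
    Computable fun a => (List.range (n a)).map (f a) :=
  (nat_rec (σ := List β) hn (const [])
    (list_concat.comp (snd.comp snd) (hf.comp (fst.pair (fst.comp snd)))).to₂).of_eq fun a => by
    induction n a with
    | zero => rfl
    | succ m ih => simp [List.range_succ, ih]

theorem list_map (d : β) {l : α → List β} {f : β → γ} (hl : Computable l)
    (hf : Computable f) : Computable fun a => (l a).map f :=
  (list_map_range (f := fun a n => f ((l a).getD n d)) (list_length.comp hl)
    (hf.comp (list_getD d (hl.comp fst) snd))).of_eq fun a => by
    apply List.ext_getElem
    · simp
    · intro i h₁ h₂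
      have : i < (l a).length := by simpa using h₁
      simp [List.getD_eq_getElem?_getD, this]

theorem iterate {n : α → ℕ} {f : α → β} {g : β → β} (hn : Computable n) (hg : Computable g)
    (hf : Computable f) : Computable fun a => g^[n a] (f a) :=
  (nat_rec hn hf (hg.comp (snd.comp snd)).to₂).of_eq fun a => by
    induction n a with
    | zero => rfl
    | succ m ih => simp only [Function.iterate_succ_apply', ← ih]

theorem bool_and {f g : α → Bool} (hf : Computable f) (hg : Computable g) :
    Computable fun a => f a && g a :=
  (cond hf hg (const false)).of_eq fun a => by cases f a <;> rfl

theorem bool_or {f g : α → Bool} (hf : Computable f) (hg : Computable g) :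
    Computable fun a => f a || g a :=
  (cond hf (const true) hg).of_eq fun a => by cases f a <;> rfl

theorem bool_not {f : α → Bool} (hf : Computable f) : Computable fun a => !f a :=
  (cond hf (const false) (const true)).of_eq fun a => by cases f a <;> rfl

theorem decide_forall_lt {n : α → ℕ} {f : α → ℕ → Bool} (hn : Computable n)
    (hf : Computable fun p : α × ℕ => f p.1 p.2) :
    Computable fun a => decide (∀ i < n a, f a i = true) :=
  (nat_rec (σ := Bool) hn (const true)
    (bool_and (snd.comp snd) (hf.comp (fst.pair (fst.comp snd)))).to₂).of_eq fun a => by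
    induction n a with
    | zero => simp
    | succ m ih =>
      rw [Bool.eq_iff_iff]
      simp only [ih, Bool.and_eq_true, decide_eq_true_eq, Nat.forall_lt_succ_right]

theorem decide_eq [DecidableEq β] {f g : α → β} (hf : Computable f) (hg : Computable g) :
    Computable fun a => decide (f a = g a) := by
  have h : Primrec₂ fun x y : β => decide (x = y) := Primrec.eq.decide
  exact h.to_comp.comp hf hg

theorem if_then_else {c : α → Prop} [DecidablePred c] {f g : α → β}
    (hc : Computable fun a => decide (c a)) (hf : Computable f) (hg : Computable g) :
    Computable fun a => if c a then f a else g a :=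
  (cond hc hf hg).of_eq fun a => by simp

theorem decide_le {f g : α → ℕ} (hf : Computable f) (hg : Computable g) :
    Computable fun a => decide (f a ≤ g a) := by
  have h : Primrec₂ fun x y : ℕ => decide (x ≤ y) := Primrec.nat_le.decide
  exact h.to_comp.comp hf hg

theorem nat_add {f g : α → ℕ} (hf : Computable f) (hg : Computable g) :
    Computable fun a => f a + g a := Primrec.nat_add.to_comp.comp hf hg

theorem nat_sub {f g : α → ℕ} (hf : Computable f) (hg : Computable g) :
    Computable fun a => f a - g a := Primrec.nat_sub.to_comp.comp hf hg

theorem nat_mul {f g : α → ℕ} (hf : Computable f) (hg : Computable g) :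
    Computable fun a => f a * g a := Primrec.nat_mul.to_comp.comp hf hg

theorem nat_max {f g : α → ℕ} (hf : Computable f) (hg : Computable g) :
    Computable fun a => max (f a) (g a) := Primrec.nat_max.to_comp.comp hf hg

theorem nat_pair {f g : α → ℕ} (hf : Computable f) (hg : Computable g) :
    Computable fun a => Nat.pair (f a) (g a) := Primrec₂.natPair.to_comp.comp hf hg

theorem nat_choose {f g : α → ℕ} (hf : Computable f) (hg : Computable g) :
    Computable fun a => (f a).choose (g a) := by
  -- The descending factorial obeys a one-term recursion in `m`, and its diagonal is the factorial
  -- in the denominator.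
  have hd : Computable₂ fun n m : ℕ => n.descFactorial m :=
    (nat_rec (f := fun p : ℕ × ℕ => p.2) (σ := ℕ) snd (const 1)
      (nat_mul (nat_sub (fst.comp fst) (fst.comp snd)) (snd.comp snd)).to₂).of_eq
      fun ⟨n, m⟩ => by
        induction m with
        | zero => simp
        | succ m ih => simp_all [Nat.descFactorial_succ]
  have hm : Computable fun m : ℕ => m.factorial :=
    (hd.comp Computable.id Computable.id).of_eq fun m => by simp [Nat.descFactorial_self]
  exact ((Primrec.nat_div.to_comp.comp (hd.comp hf hg) (hm.comp hg))).of_eq fun a =>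
    (Nat.choose_eq_descFactorial_div_factorial _ _).symm

theorem sum_range [AddCommMonoid β] (hadd : Computable₂ fun x y : β => x + y) {n : α → ℕ}
    {f : α → ℕ → β} (hn : Computable n)
    (hf : Computable fun p : α × ℕ => f p.1 p.2) :
    Computable fun a => ∑ i ∈ Finset.range (n a), f a i :=
  (nat_rec hn (const 0) (hadd.comp (snd.comp snd) (hf.comp (fst.pair (fst.comp snd)))).to₂).of_eq
    fun a => by
    induction n a with
    | zero => rfl
    | succ m ih => simp [Finset.sum_range_succ, ← ih]

theorem pow [Monoid β] (hmul : Computable₂ fun x y : β => x * y) {f : α → β} {n : α → ℕ}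
    (hf : Computable f) (hn : Computable n) : Computable fun a => f a ^ n a :=
  (nat_rec hn (const 1) (hmul.comp (snd.comp snd) (hf.comp fst)).to₂).of_eq fun a => by
    induction n a with
    | zero => simp
    | succ m ih => simp [pow_succ, ← ih]

theorem natCast [AddCommMonoidWithOne β] (hadd : Computable₂ fun x y : β => x + y) {n : α → ℕ}
    (hn : Computable n) : Computable fun a => (n a : β) :=
  (sum_range (f := fun _ _ => (1 : β)) hadd hn (const 1)).of_eq fun a => by simp

/-- Unbounded search for a code satisfying a computable test is computable if it always
succeeds. -/
theorem exists_search [Inhabited β] {p : α → β → Bool} (hp : Computable₂ p)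
    (h : ∀ a, ∃ b, p a b = true) :
    ∃ f : α → β, Computable f ∧ ∀ a, p a (f a) = true := by
  -- All natural numbers are tried as codes. Non-codes give `default`, which is harmless because the
  -- test is applied to the decoded value.
  let g : α → ℕ → β := fun _ n => (Encodable.decode n).getD default
  have hg : Computable₂ g :=
    option_getD (Computable.decode.comp snd) (const default)
  have hr := Partrec.rfind (p := fun a n => Part.some (p a (g a n)))
    ((hp.comp fst hg).to₂.partrec₂)
  have hex : ∀ a, ∃ n, p a (g a n) = true := fun a => by
    obtain ⟨b, hb⟩ := h a
    exact ⟨Encodable.encode b, by simpa [g] using hb⟩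
  classical
  refine ⟨fun a => g a (Nat.find (hex a)), hg.comp Computable.id (hr.of_eq_tot fun a => ?_),
    fun a => Nat.find_spec (hex a)⟩
  refine Nat.mem_rfind.2 ⟨?_, fun {m} hm => ?_⟩
  · simpa using (Nat.find_spec (hex a)).symm
  · simpa using Nat.find_min (hex a) hm

end Computable

/-! ### The linear system, its certificates, and their decidability. -/

section Algorithm

variable {k : Type*} [Field k] (σ : k ≃+* k) (η : k) (solve : List k × List k → List (k × List k))

/-- The coefficient of `X ^ m` in the `i`-th polynomial of a list of coefficient lists. -/
def coeffAt (a : List (List k)) (i m : ℕ) : k := (a.getD i []).getD m 0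

/-- The sum `η + σ(η) + ⋯ + σ^(i-1)(η)`, so that `σ^i(t) = t + shiftSum σ η i` if
`σ(t) = t + η`. -/
def shiftSum (i : ℕ) : k := ∑ l ∈ Finset.range i, (⇑σ)^[l] η

/-- If `N` bounds the degrees of the coefficients `a`, then the operator with coefficients `a`
maps `g t^m` to the sum of all `binom(m, b) * symbol σ η a N s b g * t^(m + N - s)`. -/
def symbol (a : List (List k)) (N s b : ℕ) (g : k) : k :=
  ∑ i ∈ Finset.range a.length,
    -- The guard keeps truncated subtraction from turning a negative index into index 0.
    (if s ≤ N + b then coeffAt a i (N + b - s) else 0) * shiftSum σ η i ^ b * (⇑σ)^[i] g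

/-- The coefficients of `X ^ N`. -/
def leadList (a : List (List k)) (N : ℕ) : List k :=
  (List.range a.length).map fun i => coeffAt a i N

/-- A list that contains all `symbol σ η a N s b u` with `s, b < r` and `u ∈ U`. -/
def symbolList (a : List (List k)) (N r : ℕ) (U : List k) : List k :=
  (List.range ((max U.length (r ^ 2) + 1) ^ 2)).map fun n =>
    symbol σ η a N n.unpair.2.unpair.1 n.unpair.2.unpair.2 (U.getD n.unpair.1 0)

/-- A list whose span over the constants contains the `r`-th coefficient from the top of each
approximate solution. -/
def candidates (a : List (List k)) (N : ℕ) : ℕ → List k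
  | 0 => (solve (leadList a N, [])).map Prod.fst
  -- The equation for coefficient `r + 1` involves only symbols with `s, b ≤ r + 1`, applied to
  -- earlier coefficients.
  | r + 1 => candidates a N r ++
      (solve (leadList a N, symbolList σ η a N (r + 2) (candidates a N r))).map Prod.fst

/-- The coefficient of the unknown `c_{i,q}` in the `r`-th coefficient from the top of the image of
`∑ c_{i,q} u_{i,q} t^(x + j - i)`, where `u_{i,q}` is the `q`-th candidate at `i`. -/
def rowEntry (a : List (List k)) (N j r i q x : ℕ) : k :=
  if i ≤ r then
    ∑ b ∈ Finset.range (j + 1), ((x + (j - i)).choose b : k) *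
      symbol σ η a N (r - i) b ((candidates σ η solve a N i).getD q 0)
  else 0

/-- The value at `x` of the polynomial with coefficients `l₀, …, l_{n-1}`. -/
def evalList (l : ℕ → k) (n x : ℕ) : k := ∑ i ∈ Finset.range n, l i * (x : k) ^ i

/-- `(N, D, p, L)` certifies that, if `x ∈ ℕ` is not a root of `p`, then the operator with
coefficients `a` lowers the degree of no polynomial of degree `x + ℓ` by `ℓ - N` or more, where
`ℓ` is the length of `a`. -/
structure IsCertificate (a : List (List k)) (c : ℕ × ℕ × List k × List k) : Prop where
  degree_le : ∀ i < a.length, ∀ m < (a.getD i []).length, m ≤ c.1 ∨ coeffAt a i m = 0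
  lead : ¬ ∀ i < a.length, coeffAt a i c.1 = 0
  const : ∀ i < c.2.2.1.length, σ (c.2.2.1.getD i 0) = c.2.2.1.getD i 0
  ne_zero : ¬ ∀ i < c.2.2.1.length, c.2.2.1.getD i 0 = 0
  length_le : c.2.2.1.length ≤ c.2.1
  -- Both sides are polynomials in `x` of degree less than `D + a.length`, so this many points
  -- determine them. The left side is the entry of `p * e_{0,q}` at position `(i, q')`.
  identity : ∀ x < c.2.1 + a.length,
    ∀ q < (candidates σ η solve a c.1 0).length,
    ∀ i < a.length + 1, ∀ q' < (candidates σ η solve a c.1 i).length,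
    (if Nat.pair i q' = Nat.pair 0 q then
      evalList (fun m => c.2.2.1.getD m 0) c.2.2.1.length x else 0) =
      ∑ r ∈ Finset.range (a.length + 1), ∑ e ∈ Finset.range c.2.1,
        evalList (fun m => c.2.2.2.getD (Nat.pair q (Nat.pair r (Nat.pair e m))) 0) c.2.1 x *
          (⇑σ)^[e] (rowEntry σ η solve a c.1 a.length r i q' x)

variable {σ} {η} {solve} [Primcodable k] {α : Type*} [Primcodable α]

theorem Computable.coeffAt {a : α → List (List k)} {i m : α → ℕ} (ha : Computable a)
    (hi : Computable i) (hm : Computable m) : Computable fun x => coeffAt (a x) (i x) (m x) :=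
  list_getD 0 (list_getD [] ha hi) hm

namespace IsComputableDifferenceField

open Computable

variable (h : IsComputableDifferenceField σ)
include h

theorem mul' {f g : α → k} (hf : Computable f) (hg : Computable g) :
    Computable fun x => f x * g x := h.mul.comp hf hg

theorem shiftSum {i : α → ℕ} (hi : Computable i) : Computable fun x => shiftSum σ η (i x) :=
  sum_range (f := fun _ l => (⇑σ)^[l] η) h.add hi (iterate snd h.sigma (const η))

theorem evalList {l : α → ℕ → k} {n x : α → ℕ} (hl : Computable fun p : α × ℕ => l p.1 p.2)
    (hn : Computable n) (hx : Computable x) :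
    Computable fun y => evalList (l y) (n y) (x y) := by
  unfold _root_.evalList
  refine sum_range h.add hn (h.mul' hl (pow h.mul ?_ snd))
  exact natCast h.add (hx.comp fst)

theorem symbol {a : α → List (List k)} {N s b : α → ℕ} {g : α → k} (ha : Computable a)
    (hN : Computable N) (hs : Computable s) (hb : Computable b) (hg : Computable g) :
    Computable fun x => symbol σ η (a x) (N x) (s x) (b x) (g x) := by
  unfold _root_.symbol
  refine sum_range h.add (list_length.comp ha) (h.mul' (h.mul' (if_then_else ?_ ?_ ?_) ?_) ?_)
  · exact decide_le (hs.comp fst) (nat_add (hN.comp fst) (hb.comp fst))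
  · exact Computable.coeffAt (ha.comp fst) snd
      (nat_sub (nat_add (hN.comp fst) (hb.comp fst)) (hs.comp fst))
  · exact const 0
  · exact pow h.mul (h.shiftSum snd) (hb.comp fst)
  · exact iterate snd h.sigma (hg.comp fst)

omit h in
theorem leadList {a : α → List (List k)} {N : α → ℕ} (ha : Computable a) (hN : Computable N) :
    Computable fun x => leadList (a x) (N x) := by
  unfold _root_.leadList
  refine list_map_range (list_length.comp ha) ?_
  exact Computable.coeffAt (ha.comp fst) snd (hN.comp fst)

theorem symbolList {a : α → List (List k)} {N r : α → ℕ} {U : α → List k} (ha : Computable a)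
    (hN : Computable N) (hr : Computable r) (hU : Computable U) :
    Computable fun x => symbolList σ η (a x) (N x) (r x) (U x) := by
  have hmul : Computable₂ fun x y : ℕ => x * y := Primrec.nat_mul.to_comp
  have h₁ : Computable fun n : ℕ => n.unpair.1 := fst.comp unpair
  have h₂ : Computable fun n : ℕ => n.unpair.2 := snd.comp unpair
  unfold _root_.symbolList
  refine list_map_range (pow hmul (nat_add (nat_max (list_length.comp hU)
    (pow hmul hr (const 2))) (const 1)) (const 2)) (h.symbol (ha.comp fst) (hN.comp fst) ?_ ?_ ?_)
  · exact h₁.comp (h₂.comp snd)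
  · exact h₂.comp (h₂.comp snd)
  · exact list_getD 0 (hU.comp fst) (h₁.comp snd)

theorem candidates (hsolve : Computable solve) {a : α → List (List k)} {N r : α → ℕ}
    (ha : Computable a) (hN : Computable N) (hr : Computable r) :
    Computable fun x => candidates σ η solve (a x) (N x) (r x) := by
  have h₀ : Computable fun x => (solve (_root_.leadList (a x) (N x), [])).map Prod.fst :=
    list_map (0, []) (hsolve.comp (pair (leadList ha hN) (const []))) fst
  have h₁ : Computable₂ fun (x : α) (y : ℕ × List k) => y.2 ++
      (solve (_root_.leadList (a x) (N x),
        _root_.symbolList σ η (a x) (N x) (y.1 + 2) y.2)).map Prod.fst :=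
    list_append.comp (snd.comp snd) (list_map (0, []) (hsolve.comp (pair
      (leadList (ha.comp fst) (hN.comp fst)) (h.symbolList (ha.comp fst) (hN.comp fst)
        (nat_add (fst.comp snd) (const 2)) (snd.comp snd)))) fst)
  refine (nat_rec hr h₀ h₁).of_eq fun x => ?_
  induction r x with
  | zero => rfl
  | succ m ih => simp only [ih, _root_.candidates]

theorem rowEntry (hsolve : Computable solve) {a : α → List (List k)} {N j r i q x : α → ℕ}
    (ha : Computable a) (hN : Computable N) (hj : Computable j) (hr : Computable r)
    (hi : Computable i) (hq : Computable q) (hx : Computable x) :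
    Computable fun y => rowEntry σ η solve (a y) (N y) (j y) (r y) (i y) (q y) (x y) := by
  unfold _root_.rowEntry
  refine if_then_else (decide_le hi hr) (sum_range h.add (nat_add hj (const 1)) (h.mul'
    (natCast h.add (nat_choose ?_ snd)) ?_)) (const 0)
  · exact (nat_add hx (nat_sub hj hi)).comp fst
  · exact h.symbol (ha.comp fst) (hN.comp fst) ((nat_sub hr hi).comp fst) snd
      ((list_getD 0 (h.candidates hsolve ha hN hi) hq).comp fst)

theorem certificate_sum (hsolve : Computable solve) {a : α → List (List k)} {L : α → List k}
    {N D x q i q' : α → ℕ} (ha : Computable a) (hL : Computable L) (hN : Computable N)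
    (hD : Computable D) (hx : Computable x) (hq : Computable q) (hi : Computable i)
    (hq' : Computable q') : Computable fun y =>
      ∑ r ∈ Finset.range ((a y).length + 1), ∑ e ∈ Finset.range (D y),
        _root_.evalList (fun m => (L y).getD (Nat.pair (q y) (Nat.pair r (Nat.pair e m))) 0)
            (D y) (x y) *
          (⇑σ)^[e] (_root_.rowEntry σ η solve (a y) (N y) (a y).length r (i y) (q' y) (x y)) := by
  refine sum_range h.add (nat_add (list_length.comp ha) (const 1))
    (sum_range h.add (hD.comp fst) (h.mul' (h.evalList ?_ ?_ ?_) (iterate snd h.sigma ?_)))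
  · refine list_getD 0 (hL.comp (fst.comp (fst.comp fst))) (nat_pair ?_ (nat_pair ?_
      (nat_pair ?_ snd)))
    · exact hq.comp (fst.comp (fst.comp fst))
    · exact snd.comp (fst.comp fst)
    · exact snd.comp fst
  · exact hD.comp (fst.comp fst)
  · exact hx.comp (fst.comp fst)
  · refine h.rowEntry hsolve ?_ ?_ ?_ ?_ ?_ ?_ ?_
    · exact ha.comp (fst.comp fst)
    · exact hN.comp (fst.comp fst)
    · exact list_length.comp (ha.comp (fst.comp fst))
    · exact snd.comp fst
    · exact hi.comp (fst.comp fst)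
    · exact hq'.comp (fst.comp fst)
    · exact hx.comp (fst.comp fst)

-- Every quantifier in a certificate is bounded and equality in `k` is decidable on codes, so the
-- test is a nest of bounded checks.
open Classical in
theorem isCertificate (hsolve : Computable solve) :
    Computable₂ fun (a : List (List k)) (c : ℕ × ℕ × List k × List k) =>
      decide (IsCertificate σ η solve a c) := by
  have ha : Computable fun p : List (List k) × ℕ × ℕ × List k × List k => p.1 := fst
  have hN : Computable fun p : List (List k) × ℕ × ℕ × List k × List k => p.2.1 := fst.comp snd
  have hD : Computable fun p : List (List k) × ℕ × ℕ × List k × List k => p.2.2.1 :=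
    fst.comp (snd.comp snd)
  have hp : Computable fun p : List (List k) × ℕ × ℕ × List k × List k => p.2.2.2.1 :=
    fst.comp (snd.comp (snd.comp snd))
  have hL : Computable fun p : List (List k) × ℕ × ℕ × List k × List k => p.2.2.2.2 :=
    snd.comp (snd.comp (snd.comp snd))
  have hl := list_length.comp ha
  have hpl := list_length.comp hp
  have h₁ : Computable fun p : List (List k) × ℕ × ℕ × List k × List k =>
      decide (∀ i < p.1.length, decide (∀ m < (p.1.getD i []).length,
        (decide (m ≤ p.2.1) || decide (coeffAt p.1 i m = 0)) = true) = true) := by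
    refine decide_forall_lt hl (decide_forall_lt ?_ (bool_or (decide_le snd ?_)
      (decide_eq (Computable.coeffAt ?_ ?_ snd) (const 0))))
    · exact list_length.comp (list_getD [] (ha.comp fst) snd)
    · exact hN.comp (fst.comp fst)
    · exact ha.comp (fst.comp fst)
    · exact snd.comp fst
  have h₂ : Computable fun p : List (List k) × ℕ × ℕ × List k × List k =>
      !decide (∀ i < p.1.length, decide (coeffAt p.1 i p.2.1 = 0) = true) := by
    refine bool_not (decide_forall_lt hl (decide_eq ?_ (const 0)))
    exact Computable.coeffAt (ha.comp fst) snd (hN.comp fst)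
  have hpi : Computable fun x : (List (List k) × ℕ × ℕ × List k × List k) × ℕ =>
      x.1.2.2.2.1.getD x.2 0 := list_getD 0 (hp.comp fst) snd
  have h₃ : Computable fun p : List (List k) × ℕ × ℕ × List k × List k =>
      decide (∀ i < p.2.2.2.1.length,
        decide (σ (p.2.2.2.1.getD i 0) = p.2.2.2.1.getD i 0) = true) :=
    decide_forall_lt hpl (decide_eq (h.sigma.comp hpi) hpi)
  have h₄ : Computable fun p : List (List k) × ℕ × ℕ × List k × List k =>
      !decide (∀ i < p.2.2.2.1.length, decide (p.2.2.2.1.getD i 0 = 0) = true) :=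
    bool_not (decide_forall_lt hpl (decide_eq hpi (const 0)))
  have h₅ := decide_le hpl hD
  have h₆ : Computable fun p : List (List k) × ℕ × ℕ × List k × List k =>
      decide (∀ x < p.2.2.1 + p.1.length,
        decide (∀ q < (_root_.candidates σ η solve p.1 p.2.1 0).length,
        decide (∀ i < p.1.length + 1,
        decide (∀ q' < (_root_.candidates σ η solve p.1 p.2.1 i).length, decide (
        (if Nat.pair i q' = Nat.pair 0 q then
          _root_.evalList (fun m => p.2.2.2.1.getD m 0) p.2.2.2.1.length x else 0) =
        ∑ r ∈ Finset.range (p.1.length + 1), ∑ e ∈ Finset.range p.2.2.1,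
        _root_.evalList (fun m => p.2.2.2.2.getD (Nat.pair q (Nat.pair r (Nat.pair e m))) 0)
            p.2.2.1 x *
          (⇑σ)^[e] (_root_.rowEntry σ η solve p.1 p.2.1 p.1.length r i q' x)) = true) = true)
            = true) = true) := by
    refine decide_forall_lt (nat_add hD hl) (decide_forall_lt (list_length.comp ?_)
      (decide_forall_lt ?_ (decide_forall_lt (list_length.comp ?_) (decide_eq
        (if_then_else (decide_eq (nat_pair ?_ ?_) (nat_pair (const 0) ?_))
          (h.evalList (list_getD 0 ?_ snd) ?_ ?_) (const 0))
        (h.certificate_sum hsolve ?_ ?_ ?_ ?_ ?_ ?_ ?_ ?_)))))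
    · exact h.candidates hsolve (ha.comp fst) (hN.comp fst) (const 0)
    · exact nat_add (hl.comp (fst.comp fst)) (const 1)
    · exact h.candidates hsolve (ha.comp (fst.comp (fst.comp fst)))
        (hN.comp (fst.comp (fst.comp fst))) snd
    · exact snd.comp fst
    · exact snd
    · exact snd.comp (fst.comp fst)
    · exact hp.comp (fst.comp (fst.comp (fst.comp (fst.comp fst))))
    · exact hpl.comp (fst.comp (fst.comp (fst.comp fst)))
    · exact snd.comp (fst.comp (fst.comp fst))
    · exact ha.comp (fst.comp (fst.comp (fst.comp fst)))
    · exact hL.comp (fst.comp (fst.comp (fst.comp fst)))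
    · exact hN.comp (fst.comp (fst.comp (fst.comp fst)))
    · exact hD.comp (fst.comp (fst.comp (fst.comp fst)))
    · exact snd.comp (fst.comp (fst.comp fst))
    · exact snd.comp (fst.comp fst)
    · exact snd.comp fst
    · exact snd
  refine (bool_and h₁ (bool_and h₂ (bool_and h₃ (bool_and h₄ (bool_and h₅ h₆))))).of_eq
    fun ⟨a, c⟩ => ?_
  rw [Bool.eq_iff_iff]
  simp only [Bool.and_eq_true, Bool.or_eq_true, decide_eq_true_eq, Bool.not_eq_true',
    decide_eq_false_iff_not]
  exact ⟨fun ⟨h₁, h₂, h₃, h₄, h₅, h₆⟩ => ⟨h₁, h₂, h₃, h₄, h₅, h₆⟩,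
    fun ⟨h₁, h₂, h₃, h₄, h₅, h₆⟩ => ⟨h₁, h₂, h₃, h₄, h₅, h₆⟩⟩

end IsComputableDifferenceField

end Algorithm

/-! ### Reduction of order and the loss of degree under a difference operator. -/

section Casoratian

/-- Summation by parts. For `u i = τ^i(q)` the differences are `τ^i(τ q - q)`, so an operator acting
on `q` becomes one of lower order acting on `τ q - q`, plus a multiple of `q`. -/
theorem sum_mul_eq_sum_mul_sub {R : Type*} [CommRing R] (B u : ℕ → R) (n : ℕ) :
    ∑ i ∈ Finset.range (n + 1), B i * u i = (∑ i ∈ Finset.range (n + 1), B i) * u 0 +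
      ∑ i ∈ Finset.range n, (∑ l ∈ Finset.Ico (i + 1) (n + 1), B l) * (u (i + 1) - u i) := by
  induction n with
  | zero => simp
  | succ n ih =>
    have h : ∀ i ∈ Finset.range n, (∑ l ∈ Finset.Ico (i + 1) (n + 1 + 1), B l) * (u (i + 1) - u i) =
        (∑ l ∈ Finset.Ico (i + 1) (n + 1), B l) * (u (i + 1) - u i) +
          B (n + 1) * (u (i + 1) - u i) := fun i hi => by
      rw [Finset.sum_Ico_succ_top (by have := Finset.mem_range.1 hi; omega), add_mul]
    rw [Finset.sum_range_succ, ih, Finset.sum_range_succ _ (n + 1),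
      Finset.sum_range_succ (fun i => _ * (u (i + 1) - u i)), Finset.sum_congr rfl h,
      Finset.sum_add_distrib, ← Finset.mul_sum, Finset.sum_range_sub]
    simp
    ring

/-- A degree function on a difference field for which the difference operator lowers a nonzero
degree by at most one. -/
structure IsDifferenceDegree {F : Type*} [Field F] (τ : F →+* F) (d : F → ℤ) : Prop where
  map_mul : ∀ x y, x ≠ 0 → y ≠ 0 → d (x * y) = d x + d y
  map_add_le : ∀ x y, x ≠ 0 → y ≠ 0 → x + y ≠ 0 → d (x + y) ≤ max (d x) (d y)
  map_map : ∀ x, x ≠ 0 → d (τ x) = d x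
  le_map_sub : ∀ x, x ≠ 0 → d x ≠ 0 → τ x - x ≠ 0 ∧ d x - 1 ≤ d (τ x - x)

namespace IsDifferenceDegree

variable {F : Type*} [Field F] {τ : F →+* F} {d : F → ℤ} (h : IsDifferenceDegree τ d)
include h

theorem map_one : d 1 = 0 := by simpa using h.map_mul 1 1 one_ne_zero one_ne_zero

theorem map_neg {x : F} (hx : x ≠ 0) : d (-x) = d x := by
  have h₁ := h.map_mul (-1) (-1) (by simp) (by simp)
  have h₂ := h.map_mul (-1) x (by simp) hx
  rw [neg_mul_neg, one_mul, h.map_one] at h₁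
  rw [neg_one_mul] at h₂
  omega

theorem map_div {x y : F} (hx : x ≠ 0) (hy : y ≠ 0) : d (x / y) = d x - d y := by
  have := h.map_mul (x / y) y (div_ne_zero hx hy) hy
  rw [div_mul_cancel₀ _ hy] at this
  omega

theorem map_iterate {x : F} (hx : x ≠ 0) (n : ℕ) : τ^[n] x ≠ 0 ∧ d (τ^[n] x) = d x := by
  induction n with
  | zero => exact ⟨hx, rfl⟩
  | succ n ih =>
    rw [Function.iterate_succ_apply']
    exact ⟨by simpa using ih.1, by rw [h.map_map _ ih.1, ih.2]⟩

theorem map_sub_le {x : F} (hx : x ≠ 0) (hne : τ x - x ≠ 0) : d (τ x - x) ≤ d x := by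
  have := h.map_add_le (τ x) (-x) (by simpa using hx) (by simpa using hx)
    (by rwa [← sub_eq_add_neg])
  rw [← sub_eq_add_neg, h.map_neg hx, h.map_map x hx] at this
  simpa using this

/-- Adding an element of smaller degree. -/
theorem le_map_add {x y : F} {m : ℤ} (hx : x ≠ 0) (hm : m ≤ d x) (hy : y = 0 ∨ d y < m) :
    y + x ≠ 0 ∧ m ≤ d (y + x) := by
  rcases eq_or_ne y 0 with rfl | hy'
  · simpa using ⟨hx, hm⟩
  have hlt : d y < m := hy.resolve_left hy'
  have hne : y + x ≠ 0 := fun hyx => by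
    rw [eq_neg_of_add_eq_zero_right hyx, h.map_neg hy'] at hm
    omega
  refine ⟨hne, ?_⟩
  have := h.map_add_le (y + x) (-y) hne (by simpa using hy') (by simpa using hx)
  rw [h.map_neg hy', add_neg_cancel_comm] at this
  rcases le_max_iff.1 this <;> omega

theorem le_map_or {x y : F} {m : ℤ} (hxy : x + y ≠ 0) (hm : m ≤ d (x + y)) :
    (x ≠ 0 ∧ m ≤ d x) ∨ (y ≠ 0 ∧ m ≤ d y) := by
  rcases eq_or_ne x 0 with rfl | hx
  · right
    simpa using And.intro hxy hm
  rcases eq_or_ne y 0 with rfl | hy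
  · left
    simpa using And.intro hxy hm
  have := h.map_add_le x y hx hy hxy
  rcases le_max_iff.1 this with h' | h'
  · exact Or.inl ⟨hx, hm.trans h'⟩
  · exact Or.inr ⟨hy, hm.trans h'⟩

/-- A difference operator of order `n` cannot lower the degrees of `n + 1` elements with
well separated degrees by more than `n`. -/
theorem exists_le_map_operator (n : ℕ) : ∀ (f b : ℕ → F) (m : ℤ), (∀ s ≤ n, f s ≠ 0) →
    (∀ s ≤ n, ∀ s' < s, d (f s') + n + 1 ≤ d (f s)) → (∃ i ≤ n, b i ≠ 0 ∧ m ≤ d (b i)) →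
    ∃ s ≤ n, ∑ i ∈ Finset.range (n + 1), b i * τ^[i] (f s) ≠ 0 ∧
      d (f s) + m - n ≤ d (∑ i ∈ Finset.range (n + 1), b i * τ^[i] (f s)) := by
  induction n with
  | zero =>
    rintro f b m hf - ⟨i, hi, hb, hm⟩
    obtain rfl : i = 0 := by omega
    have h₀ := hf 0 le_rfl
    refine ⟨0, le_rfl, by simpa using ⟨hb, h₀⟩, ?_⟩
    simp only [zero_add, Finset.range_one, Finset.sum_singleton, Function.iterate_zero, id]
    rw [h.map_mul _ _ hb h₀]
    push_cast
    omega
  | succ n ih =>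
    rintro f b m hf hgap ⟨i, hi, hb, hm⟩
    have h₀ := hf 0 (by omega)
    -- Reduction of order: substituting `f = f 0 * q` gives the operator with coefficients `B`. The
    -- value at `q = 1` is `R`, the image of `f 0`; the tail sums `B'` are the coefficients of the
    -- operator acting on `τ q - q`.
    set B : ℕ → F := fun i => b i * τ^[i] (f 0) with hB
    set B' : ℕ → F := fun i => ∑ l ∈ Finset.Ico (i + 1) (n + 2), B l with hB'
    set R : F := ∑ i ∈ Finset.range (n + 2), B i with hR
    by_cases hs : R ≠ 0 ∧ d (f 0) + m - (n + 1 : ℕ) ≤ d R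
    · exact ⟨0, by omega, hs⟩
    have hs' : R = 0 ∨ d R < d (f 0) + m - (n + 1 : ℕ) := by
      by_cases hR0 : R = 0
      · exact Or.inl hR0
      · exact Or.inr (not_le.1 fun hle => hs ⟨hR0, hle⟩)
    have hBi : B i ≠ 0 ∧ d (f 0) + m ≤ d (B i) := by
      have := h.map_iterate h₀ i
      refine ⟨mul_ne_zero hb this.1, ?_⟩
      rw [hB, h.map_mul _ _ hb this.1, this.2]
      omega
    have hstep : ∀ l < n + 1, B l + B' l = ∑ e ∈ Finset.Ico l (n + 2), B e := fun l hl => by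
      rw [Finset.sum_eq_sum_Ico_succ_bot (by omega)]
    -- The large `B i` is a difference of consecutive tails, where the full tail `R` is small and
    -- the last tail is `B (n + 1)`. Hence some tail among `B' 0, …, B' n` is large.
    have hbig : ∃ l ≤ n, B' l ≠ 0 ∧ d (f 0) + m ≤ d (B' l) := by
      rcases Nat.eq_zero_or_pos i with rfl | hpos
      · have h₁ : R + -B' 0 = B 0 := by
          rw [hR, Finset.range_eq_Ico, ← hstep 0 (by omega)]
          ring
        rw [← h₁] at hBi
        rcases h.le_map_or hBi.1 hBi.2 with ⟨h₂, h₃⟩ | ⟨h₂, h₃⟩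
        · rcases hs' with h₄ | h₄
          · exact absurd h₄ h₂
          · push_cast at h₄
            omega
        · have h₅ : B' 0 ≠ 0 := by simpa using h₂
          exact ⟨0, by omega, h₅, by rwa [h.map_neg h₅] at h₃⟩
      · obtain ⟨l, rfl⟩ : ∃ l, i = l + 1 := ⟨i - 1, by omega⟩
        rcases Nat.lt_or_ge l n with hl | hl
        · have h₁ : B' l + -B' (l + 1) = B (l + 1) := by
            have := hstep (l + 1) (by omega)
            rw [← hB'] at *
            change _ = B' l at this
            rw [← this]
            ring
          rw [← h₁] at hBi
          rcases h.le_map_or hBi.1 hBi.2 with ⟨h₂, h₃⟩ | ⟨h₂, h₃⟩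
          · exact ⟨l, by omega, h₂, h₃⟩
          · have h₅ : B' (l + 1) ≠ 0 := by simpa using h₂
            exact ⟨l + 1, by omega, h₅, by rwa [h.map_neg h₅] at h₃⟩
        · obtain rfl : l = n := by omega
          have h₁ : B' l = B (l + 1) := by simp [hB']
          exact ⟨l, le_rfl, by rwa [h₁]⟩
    have hq : ∀ s ≤ n, f (s + 1) / f 0 ≠ 0 ∧
        d (f (s + 1) / f 0) = d (f (s + 1)) - d (f 0) ∧ d (f (s + 1) / f 0) ≠ 0 := fun s hs => by
      have h₁ := hf (s + 1) (by omega)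
      have h₂ := hgap (s + 1) (by omega) 0 (by omega)
      have h₃ := h.map_div h₁ h₀
      exact ⟨div_ne_zero h₁ h₀, h₃, by omega⟩
    -- Each quotient has nonzero degree by the gap condition, so taking the difference costs at most
    -- one degree. The gaps thus shrink from `n + 2` to `n + 1`, as the induction hypothesis
    -- requires.
    have hg : ∀ s ≤ n, τ (f (s + 1) / f 0) - f (s + 1) / f 0 ≠ 0 ∧
        d (f (s + 1)) - d (f 0) - 1 ≤ d (τ (f (s + 1) / f 0) - f (s + 1) / f 0) ∧
        d (τ (f (s + 1) / f 0) - f (s + 1) / f 0) ≤ d (f (s + 1)) - d (f 0) := fun s hs => by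
      obtain ⟨h₁, h₂, h₃⟩ := hq s hs
      obtain ⟨h₄, h₅⟩ := h.le_map_sub _ h₁ h₃
      have := h.map_sub_le h₁ h₄
      exact ⟨h₄, by omega, by omega⟩
    obtain ⟨s, hsn, hS, hS'⟩ := ih (fun s => τ (f (s + 1) / f 0) - f (s + 1) / f 0) B'
      (d (f 0) + m) (fun s hs => (hg s hs).1) (fun s hs s' hs' => by
        have h₁ := hg s hs
        have h₂ := hg s' (by omega)
        have h₃ := hgap (s + 1) (by omega) (s' + 1) (by omega)
        push_cast at h₃
        omega) hbig
    have hsum : ∑ i ∈ Finset.range (n + 1 + 1), b i * τ^[i] (f (s + 1)) =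
        R * (f (s + 1) / f 0) +
          ∑ i ∈ Finset.range (n + 1), B' i * τ^[i] (τ (f (s + 1) / f 0) - f (s + 1) / f 0) := by
      have h₁ := sum_mul_eq_sum_mul_sub B (fun i => τ^[i] (f (s + 1) / f 0)) (n + 1)
      simp only [Function.iterate_zero, id] at h₁
      rw [hR, hB']
      convert h₁ using 1
      · refine Finset.sum_congr rfl fun i _ => ?_
        rw [hB, mul_assoc, ← iterate_map_mul, mul_div_cancel₀ _ h₀]
      · congr 1
        refine Finset.sum_congr rfl fun i _ => ?_
        rw [iterate_map_sub, Function.iterate_succ_apply]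
    obtain ⟨h₁, h₂, -⟩ := hq s hsn
    obtain ⟨-, h₃, -⟩ := hg s hsn
    refine ⟨s + 1, by omega, ?_⟩
    rw [hsum]
    -- The degree of `R * (f (s + 1) / f 0)` lies below the claimed bound, so this term cannot
    -- cancel the other one.
    refine h.le_map_add hS (by push_cast at hS' ⊢; omega) ?_
    rcases eq_or_ne R 0 with h₄ | h₄
    · left
      rw [h₄, zero_mul]
    · right
      have := hs'.resolve_left h₄
      rw [h.map_mul _ _ h₄ h₁, h₂]
      push_cast at this ⊢
      omega

end IsDifferenceDegree

end Casoratian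

/-! ### The shift `X ↦ X + η` on polynomials and rational functions. -/

section PolyShift

variable {k : Type*} [Field k]

/-- The extension of `σ` to `k[X]` that maps `X` to `X + η`. -/
noncomputable def polyShift (σ : k ≃+* k) (η : k) : k[X] →+* k[X] :=
  (compRingHom (X + C η)).comp (mapRingHom (σ : k →+* k))

variable (σ : k ≃+* k) (η : k)

theorem polyShift_apply (p : k[X]) :
    polyShift σ η p = (p.map (σ : k →+* k)).comp (X + C η) := rfl

@[simp] theorem polyShift_C (c : k) : polyShift σ η (C c) = C (σ c) := by
  simp [polyShift_apply]

@[simp] theorem polyShift_X : polyShift σ η X = X + C η := by simp [polyShift_apply]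

theorem natDegree_polyShift (p : k[X]) : (polyShift σ η p).natDegree = p.natDegree := by
  rw [polyShift_apply, natDegree_comp, natDegree_X_add_C, mul_one,
    natDegree_map_eq_of_injective (RingHom.injective _)]

theorem polyShift_injective : Function.Injective (polyShift σ η) := by
  rw [injective_iff_map_eq_zero]
  intro p hp
  by_contra hne
  have h₁ := natDegree_polyShift σ η p
  rw [hp, natDegree_zero] at h₁
  obtain ⟨c, rfl⟩ : ∃ c, p = C c := ⟨_, eq_C_of_natDegree_eq_zero h₁.symm⟩
  rw [polyShift_C] at hp
  simp_all

theorem polyShift_iterate (i : ℕ) (g : k) (m : ℕ) :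
    (polyShift σ η)^[i] (C g * X ^ m) = C ((⇑σ)^[i] g) * (X + C (shiftSum σ η i)) ^ m := by
  induction i with
  | zero => simp [shiftSum]
  | succ i ih =>
    have h : η + σ (shiftSum σ η i) = shiftSum σ η (i + 1) := by
      simp only [shiftSum, map_sum, Finset.sum_range_succ']
      simp only [← Function.iterate_succ_apply' (f := ⇑σ)]
      simp [add_comm]
    rw [Function.iterate_succ_apply', ih, map_mul, map_pow, map_add, polyShift_C, polyShift_C,
      polyShift_X, Function.iterate_succ_apply', ← h, C_add, add_assoc]

variable {σ} {η}

theorem coeff_polyShift_iterate {p : k[X]} {N : ℕ} (hp : p.natDegree < N) (i d : ℕ) :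
    ((polyShift σ η)^[i] p).coeff d = ∑ m ∈ Finset.range N,
      (⇑σ)^[i] (p.coeff m) * (shiftSum σ η i ^ (m - d) * (m.choose d : k)) := by
  conv_lhs => rw [p.as_sum_range_C_mul_X_pow' hp]
  have h : (polyShift σ η)^[i] (∑ m ∈ Finset.range N, C (p.coeff m) * X ^ m) =
      ∑ m ∈ Finset.range N, (polyShift σ η)^[i] (C (p.coeff m) * X ^ m) := by
    simp only [← RingHom.coe_pow, map_sum]
  rw [h, finsetSum_coeff]
  refine Finset.sum_congr rfl fun m _ => ?_
  rw [polyShift_iterate, coeff_C_mul, coeff_X_add_C_pow]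

theorem coeff_polyShift_top {p : k[X]} {n : ℕ} (hp : p.natDegree ≤ n) :
    (polyShift σ η p).coeff n = σ (p.coeff n) := by
  have h := coeff_polyShift_iterate (σ := σ) (η := η) (Nat.lt_succ_of_le hp) 1 n
  rw [Function.iterate_one] at h
  rw [h, Finset.sum_range_succ, Finset.sum_eq_zero]
  · simp
  · intro m hm
    simp [Nat.choose_eq_zero_of_lt (Finset.mem_range.1 hm)]

theorem coeff_polyShift_sub_one {p : k[X]} {n : ℕ} (hp : p.natDegree ≤ n + 1) :
    (polyShift σ η p).coeff n =
      σ (p.coeff n) + (n + 1) * η * σ (p.coeff (n + 1)) := by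
  have h := coeff_polyShift_iterate (σ := σ) (η := η) (Nat.lt_succ_of_le hp) 1 n
  rw [Function.iterate_one] at h
  rw [h, Finset.sum_range_succ, Finset.sum_range_succ, Finset.sum_eq_zero]
  · simp [shiftSum]
    ring
  · intro m hm
    simp [Nat.choose_eq_zero_of_lt (Finset.mem_range.1 hm)]

theorem coeff_mul_of_natDegree_le_succ {p q : k[X]} {m n : ℕ} (hp : p.natDegree ≤ m + 1)
    (hq : q.natDegree ≤ n + 1) :
    (p * q).coeff (m + n + 1) = p.coeff (m + 1) * q.coeff n + p.coeff m * q.coeff (n + 1) := by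
  rw [coeff_mul, Finset.sum_eq_add (m + 1, n) (m, n + 1)]
  · simp
  · rintro ⟨x, y⟩ hxy ⟨h₁, h₂⟩
    have hxy' : x + y = m + n + 1 := Finset.HasAntidiagonal.mem_antidiagonal.1 hxy
    rw [ne_eq, Prod.mk.injEq] at h₁ h₂
    rcases Nat.lt_or_ge (m + 1) x with h | h
    · simp [coeff_eq_zero_of_natDegree_lt (hp.trans_lt h)]
    · have : n + 1 < y := by omega
      simp [coeff_eq_zero_of_natDegree_lt (hq.trans_lt this)]
  · intro h
    exact absurd (by simp; omega) h
  · intro h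
    exact absurd (by simp; omega) h

/-- This is the numerator of `τ(p/q) - p/q` with `p/q` written as `Xp/Xq`, so that a next-to-leading
coefficient exists even for constant `p` or `q`. If its two highest possible coefficients vanished,
the first would make the ratio of the leading coefficients a constant, and the second would then
exhibit `η` as some `σ(g) - g`. -/
theorem polyShift_mul_sub_ne_zero [CharZero k] (hη : ∀ g : k, σ g - g ≠ η) {p q : k[X]} (hp : p ≠ 0)
    (hq : q ≠ 0) (hpq : p.natDegree ≠ q.natDegree) :
    polyShift σ η (X * p) * (X * q) - X * p * polyShift σ η (X * q) ≠ 0 ∧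
      p.natDegree + q.natDegree + 1 ≤
        (polyShift σ η (X * p) * (X * q) - X * p * polyShift σ η (X * q)).natDegree := by
  set m := p.natDegree
  set n := q.natDegree
  have hm : (X * p).natDegree = m + 1 := natDegree_X_mul hp
  have hn : (X * q).natDegree = n + 1 := natDegree_X_mul hq
  have hm' := (natDegree_polyShift σ η (X * p)).trans hm
  have hn' := (natDegree_polyShift σ η (X * q)).trans hn
  suffices h : ∃ e, m + n + 1 ≤ e ∧
      (polyShift σ η (X * p) * (X * q) - X * p * polyShift σ η (X * q)).coeff e ≠ 0 by
    obtain ⟨e, he, hne⟩ := h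
    exact ⟨fun h => hne (by rw [h, coeff_zero]), he.trans (le_natDegree_of_ne_zero hne)⟩
  by_contra! hcon
  have h₀ := hcon (m + n + 1) le_rfl
  have h₁ := hcon ((m + 1) + (n + 1)) (by omega)
  rw [coeff_sub, coeff_mul_add_eq_of_natDegree_le hm'.le hn.le,
    coeff_mul_add_eq_of_natDegree_le hm.le hn'.le, coeff_polyShift_top hm.le,
    coeff_polyShift_top hn.le] at h₁
  rw [coeff_sub, coeff_mul_of_natDegree_le_succ hm'.le hn.le,
    coeff_mul_of_natDegree_le_succ hm.le hn'.le, coeff_polyShift_top hm.le,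
    coeff_polyShift_top hn.le, coeff_polyShift_sub_one hm.le, coeff_polyShift_sub_one hn.le] at h₀
  have ha : (X * p).coeff (m + 1) ≠ 0 := by
    rw [← hm]
    exact leadingCoeff_ne_zero.2 (mul_ne_zero X_ne_zero hp)
  have hb : (X * q).coeff (n + 1) ≠ 0 := by
    rw [← hn]
    exact leadingCoeff_ne_zero.2 (mul_ne_zero X_ne_zero hq)
  generalize (X * p).coeff (m + 1) = a at *
  generalize (X * q).coeff (n + 1) = b at *
  generalize (X * p).coeff m = a' at *
  generalize (X * q).coeff n = b' at *
  have hσa : σ a ≠ 0 := by simpa using ha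
  have hσb : σ b ≠ 0 := by simpa using hb
  have hnm : (n : k) - m ≠ 0 := sub_ne_zero.2 (by exact_mod_cast hpq.symm)
  refine hη ((a' / a - b' / b) / (n - m)) ?_
  simp only [map_div₀, map_sub, map_natCast]
  field_simp
  linear_combination (a * σ b) * h₀ - (a * σ b' + a' * σ b + (n + 1) * η * a * σ b) * h₁

/-- The extension of `polyShift σ η` to rational functions. -/
noncomputable def ratFuncShift (σ : k ≃+* k) (η : k) : RatFunc k →+* RatFunc k :=
  RatFunc.mapRingHom (polyShift σ η)
    (nonZeroDivisors_le_comap_nonZeroDivisors_of_injective _ (polyShift_injective σ η))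

theorem ratFuncShift_algebraMap (p : k[X]) :
    ratFuncShift σ η (algebraMap k[X] (RatFunc k) p) =
      algebraMap k[X] (RatFunc k) (polyShift σ η p) := by
  have h := RatFunc.map_apply_div (polyShift σ η)
    (nonZeroDivisors_le_comap_nonZeroDivisors_of_injective _ (polyShift_injective σ η)) p 1
  rw [map_one, map_one, map_one, div_one, div_one] at h
  exact h

theorem isDifferenceDegree_intDegree [CharZero k] (hη : ∀ g : k, σ g - g ≠ η) :
    IsDifferenceDegree (ratFuncShift σ η) RatFunc.intDegree := by
  have hrep : ∀ x : RatFunc k, x ≠ 0 → ∃ p q : k[X], p ≠ 0 ∧ q ≠ 0 ∧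
      x = algebraMap k[X] (RatFunc k) p / algebraMap k[X] (RatFunc k) q := fun x hx =>
    ⟨x.num, x.denom, RatFunc.num_ne_zero hx, x.denom_ne_zero, x.num_div_denom.symm⟩
  have hne : ∀ {p : k[X]}, p ≠ 0 → algebraMap k[X] (RatFunc k) p ≠ 0 := fun hp =>
    RatFunc.algebraMap_ne_zero hp
  have hdeg : ∀ p q : k[X], p ≠ 0 → q ≠ 0 → RatFunc.intDegree
      (algebraMap k[X] (RatFunc k) p / algebraMap k[X] (RatFunc k) q) =
      p.natDegree - q.natDegree := fun p q hp hq => by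
    rw [RatFunc.intDegree_div (hne hp) (hne hq),
      RatFunc.intDegree_polynomial, RatFunc.intDegree_polynomial]
  refine ⟨fun x y hx hy => RatFunc.intDegree_mul hx hy,
    fun x y _ hy hxy => RatFunc.intDegree_add_le hy hxy, fun x hx => ?_, fun x hx hd => ?_⟩
  · obtain ⟨p, q, hp, hq, rfl⟩ := hrep x hx
    rw [map_div₀, ratFuncShift_algebraMap, ratFuncShift_algebraMap, hdeg _ _ hp hq,
      hdeg _ _ ((map_ne_zero_iff _ (polyShift_injective σ η)).2 hp)
        ((map_ne_zero_iff _ (polyShift_injective σ η)).2 hq),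
      natDegree_polyShift, natDegree_polyShift]
  · obtain ⟨p, q, hp, hq, rfl⟩ := hrep x hx
    rw [hdeg _ _ hp hq] at hd ⊢
    obtain ⟨h₁, h₂⟩ := polyShift_mul_sub_ne_zero hη hp hq (by omega)
    have hXq : X * q ≠ 0 := mul_ne_zero X_ne_zero hq
    have hXq' : polyShift σ η (X * q) ≠ 0 :=
      (map_ne_zero_iff _ (polyShift_injective σ η)).2 hXq
    have hX : algebraMap k[X] (RatFunc k) X ≠ 0 := hne X_ne_zero
    -- With this representation the denominator of the difference has degree `2 * (deg q + 1)` and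
    -- the numerator at least `deg p + deg q + 1`.
    have heq : algebraMap k[X] (RatFunc k) p / algebraMap k[X] (RatFunc k) q =
        algebraMap k[X] (RatFunc k) (X * p) / algebraMap k[X] (RatFunc k) (X * q) := by
      rw [map_mul, map_mul, mul_div_mul_left _ _ hX]
    have hsub : ratFuncShift σ η (algebraMap k[X] (RatFunc k) p / algebraMap k[X] (RatFunc k) q) -
        algebraMap k[X] (RatFunc k) p / algebraMap k[X] (RatFunc k) q =
        algebraMap k[X] (RatFunc k) (polyShift σ η (X * p) * (X * q) -
          X * p * polyShift σ η (X * q)) /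
        algebraMap k[X] (RatFunc k) (polyShift σ η (X * q) * (X * q)) := by
      rw [heq, map_div₀, ratFuncShift_algebraMap, ratFuncShift_algebraMap,
        div_sub_div _ _ (hne hXq') (hne hXq)]
      simp only [map_sub, map_mul]
      ring
    have hden := mul_ne_zero hXq' hXq
    rw [hsub, hdeg _ _ h₁ hden, natDegree_mul hXq' hXq, natDegree_polyShift, natDegree_X_mul hq]
    refine ⟨div_ne_zero (hne h₁) (hne hden), ?_⟩
    push_cast
    omega

end PolyShift

/-! ### Coefficients of the image of a polynomial under the operator. -/

section Operator

variable {k : Type*} [Field k]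

theorem coeff_polyOfList (p : List k) (m : ℕ) : (polyOfList p).coeff m = p.getD m 0 := by
  rw [polyOfList, finsetSum_coeff]
  simp only [coeff_monomial]
  rcases lt_or_ge m p.length with h | h
  · rw [Finset.sum_eq_single ⟨m, h⟩]
    · simp [h]
    · intro i _ hi
      rw [if_neg]
      exact fun h' => hi (Fin.ext h')
    · simp
  · rw [Finset.sum_eq_zero]
    · simp [h]
    · intro i _
      rw [if_neg]
      have := i.2
      omega

theorem natDegree_polyOfList_lt {p : List k} {n : ℕ} (hn : 0 < n) (hp : p.length ≤ n) :
    (polyOfList p).natDegree < n := by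
  have h : (polyOfList p).natDegree ≤ n - 1 := natDegree_le_iff_coeff_eq_zero.2 fun m hm => by
    rw [coeff_polyOfList, List.getD_eq_default _ _ (by omega)]
  omega

theorem applyOperator_eq_sum_range {R : Type*} [CommRing R] (σ : R ≃+* R) (a : List R) (g : R) :
    applyOperator σ a g = ∑ i ∈ Finset.range a.length, a.getD i 0 * (⇑σ)^[i] g := by
  rw [applyOperator, Finset.sum_range]
  simp

variable (σ : k ≃+* k) (η : k)

/-- The difference operator on `k[X]` with respect to `polyShift σ η`. -/
noncomputable def polyOperator (a : List (List k)) (y : k[X]) : k[X] :=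
  ∑ i ∈ Finset.range a.length, polyOfList (a.getD i []) * (polyShift σ η)^[i] y

variable {σ} {η}

theorem coeff_mul_X_add_C_pow {A : k[X]} {N : ℕ} (hA : ∀ m, N < m → A.coeff m = 0) (g c : k)
    {n i j r : ℕ} (hi : i ≤ n) (hr : r ≤ j) (hj : j ≤ n) :
    (A * (C g * (X + C c) ^ (n - i))).coeff (n + N - r) =
      if i ≤ r then ∑ b ∈ Finset.range (j + 1), ((n - i).choose b : k) *
        ((if r - i ≤ N + b then A.coeff (N + b - (r - i)) else 0) * c ^ b * g) else 0 := by
  have h₁ : (A * (C g * (X + C c) ^ (n - i))).coeff (n + N - r) =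
      ∑ b ∈ Finset.range (n - i + 1), ((n - i).choose b : k) *
        ((if r ≤ N + b + i then A.coeff (N + b + i - r) else 0) * c ^ b * g) := by
    rw [add_comm X, add_pow, Finset.mul_sum, Finset.mul_sum, finsetSum_coeff]
    refine Finset.sum_congr rfl fun b hb => ?_
    have hb' : b ≤ n - i := Nat.lt_succ_iff.1 (Finset.mem_range.1 hb)
    have h₂ : A * (C g * (C c ^ b * X ^ (n - i - b) * ((n - i).choose b : k[X]))) =
        C (g * c ^ b * ((n - i).choose b : k)) * (A * X ^ (n - i - b)) := by
      simp only [C_mul, C_pow, map_natCast]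
      ring
    rw [h₂, coeff_C_mul, coeff_mul_X_pow']
    by_cases h₃ : r ≤ N + b + i
    · rw [if_pos h₃, if_pos (by omega), show n + N - r - (n - i - b) = N + b + i - r by omega]
      ring
    · rw [if_neg h₃, if_neg (by omega)]
      ring
  rw [h₁]
  split_ifs with hir
  · have h₂ : ∀ b, (if r ≤ N + b + i then A.coeff (N + b + i - r) else 0) =
        if r - i ≤ N + b then A.coeff (N + b - (r - i)) else 0 := fun b => by
      by_cases h₃ : r ≤ N + b + i
      · rw [if_pos h₃, if_pos (by omega), show N + b + i - r = N + b - (r - i) by omega]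
      · rw [if_neg h₃, if_neg (by omega)]
    simp only [h₂]
    -- The range of `b` may be changed freely: the binomial vanishes for `b > n - i`, and for `b > r
    -- - i` the index of the coefficient of `A` exceeds `N`. So the number of terms need not depend
    -- on `n`.
    have h₃ : ∀ M M' : ℕ, M ≤ M' → (∀ b, M ≤ b → n - i < b ∨ r - i < b) →
        ∑ b ∈ Finset.range M, ((n - i).choose b : k) *
          ((if r - i ≤ N + b then A.coeff (N + b - (r - i)) else 0) * c ^ b * g) =
        ∑ b ∈ Finset.range M', ((n - i).choose b : k) *
          ((if r - i ≤ N + b then A.coeff (N + b - (r - i)) else 0) * c ^ b * g) :=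
      fun M M' hM h => by
        refine Finset.sum_subset (Finset.range_mono hM) fun b _ hb => ?_
        rcases h b (by simpa using hb) with h' | h'
        · simp [Nat.choose_eq_zero_of_lt h']
        · rw [hA _ (by omega)]
          simp
    rw [h₃ (n - i + 1) (n + 1) (by omega) (fun b hb => by omega),
      h₃ (j + 1) (n + 1) (by omega) (fun b hb => by omega)]
  · refine Finset.sum_eq_zero fun b _ => ?_
    rw [hA (N + b + i - r) (by omega)]
    simp

/-- The highest coefficients of the image depend only on the highest coefficients of `y`, and on the
degree only through binomials with bounded lower index. -/
theorem coeff_polyOperator {a : List (List k)} {N : ℕ}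
    (hN : ∀ i < a.length, ∀ m, N < m → coeffAt a i m = 0) {y : k[X]} {n j r : ℕ}
    (hy : y.natDegree ≤ n) (hr : r ≤ j) (hj : j ≤ n) :
    (polyOperator σ η a y).coeff (n + N - r) = ∑ i ∈ Finset.range (r + 1),
      ∑ b ∈ Finset.range (j + 1),
        ((n - i).choose b : k) * symbol σ η a N (r - i) b (y.coeff (n - i)) := by
  have h₁ : y = ∑ i ∈ Finset.range (n + 1), C (y.coeff (n - i)) * X ^ (n - i) := by
    conv_lhs => rw [y.as_sum_range_C_mul_X_pow' (Nat.lt_succ_of_le hy)]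
    rw [← Finset.sum_range_reflect]
    simp
  have h₂ : ∀ l, (polyShift σ η)^[l] y = ∑ i ∈ Finset.range (n + 1),
      C ((⇑σ)^[l] (y.coeff (n - i))) * (X + C (shiftSum σ η l)) ^ (n - i) := fun l => by
    conv_lhs => rw [h₁]
    simp only [← polyShift_iterate]
    simp only [← RingHom.coe_pow, map_sum]
  rw [polyOperator, finsetSum_coeff]
  have h₃ : ∀ l ∈ Finset.range a.length,
      (polyOfList (a.getD l []) * (polyShift σ η)^[l] y).coeff (n + N - r) =
      ∑ i ∈ Finset.range (r + 1), ∑ b ∈ Finset.range (j + 1), ((n - i).choose b : k) *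
        ((if r - i ≤ N + b then coeffAt a l (N + b - (r - i)) else 0) * shiftSum σ η l ^ b *
          (⇑σ)^[l] (y.coeff (n - i))) := fun l hl => by
    have h₄ : ∀ m, N < m → (polyOfList (a.getD l [])).coeff m = 0 := fun m hm => by
      rw [coeff_polyOfList]
      exact hN l (Finset.mem_range.1 hl) m hm
    rw [h₂, Finset.mul_sum, finsetSum_coeff, Finset.sum_congr rfl fun i hi =>
      coeff_mul_X_add_C_pow h₄ _ _ (Nat.lt_succ_iff.1 (Finset.mem_range.1 hi)) hr hj,
      ← Finset.sum_subset (Finset.range_mono (show r + 1 ≤ n + 1 by omega))]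
    · refine Finset.sum_congr rfl fun i hi => ?_
      rw [if_pos (Nat.lt_succ_iff.1 (Finset.mem_range.1 hi))]
      simp only [coeff_polyOfList, coeffAt]
    · intro i _ hi
      rw [if_neg fun h => hi (Finset.mem_range.2 (Nat.lt_succ_of_le h))]
  rw [Finset.sum_congr rfl h₃, Finset.sum_comm]
  refine Finset.sum_congr rfl fun i _ => ?_
  rw [Finset.sum_comm]
  simp only [symbol, Finset.mul_sum]

theorem symbol_eq_zero {a : List (List k)} {N : ℕ}
    (hN : ∀ i < a.length, ∀ m, N < m → coeffAt a i m = 0) {s b : ℕ} (hsb : s < b) (g : k) :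
    symbol σ η a N s b g = 0 := by
  refine Finset.sum_eq_zero fun i hi => ?_
  rw [hN i (Finset.mem_range.1 hi) _ (by omega)]
  simp

theorem applyOperator_leadList (a : List (List k)) (N : ℕ) (g : k) :
    applyOperator σ (leadList a N) g = symbol σ η a N 0 0 g := by
  rw [applyOperator_eq_sum_range, symbol, leadList]
  simp only [List.length_map, List.length_range]
  refine Finset.sum_congr rfl fun i hi => ?_
  have := Finset.mem_range.1 hi
  simp [List.getD_eq_getElem?_getD, this]

theorem iterate_constField (n : ℕ) {c : k} (hc : c ∈ constField σ) : (⇑σ)^[n] c = c :=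
  Function.iterate_fixed hc n

/-- `symbol` as a linear map over the constants. -/
noncomputable def symbolLinear (σ : k ≃+* k) (η : k) (a : List (List k)) (N s b : ℕ) :
    k →ₗ[constField σ] k where
  toFun := symbol σ η a N s b
  map_add' x y := by
    simp only [symbol, iterate_map_add, mul_add, Finset.sum_add_distrib]
  map_smul' c x := by
    simp only [symbol, Subfield.smul_def, smul_eq_mul, iterate_map_mul, iterate_constField _ c.2,
      Finset.mul_sum, RingHom.id_apply]
    exact Finset.sum_congr rfl fun i _ => by ring

theorem symbolLinear_apply (a : List (List k)) (N s b : ℕ) (g : k) :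
    symbolLinear σ η a N s b g = symbol σ η a N s b g := rfl

theorem mem_span_list {U : List k} {z : k} :
    z ∈ Submodule.span (constField σ) {u | u ∈ U} ↔ ∃ c : ℕ → k, (∀ q, c q ∈ constField σ) ∧
      z = ∑ q ∈ Finset.range U.length, c q * U.getD q 0 := by
  have h : {u | u ∈ U} = Set.range U.get := by
    rw [Set.range_list_get]
  rw [h, Submodule.mem_span_range_iff_exists_fun]
  constructor
  · rintro ⟨c, rfl⟩
    refine ⟨fun q => if hq : q < U.length then c ⟨q, hq⟩ else 0, fun q => ?_, ?_⟩
    · dsimp only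
      split_ifs
      · exact (c _).2
      · exact zero_mem _
    · rw [Finset.sum_range]
      simp [Subfield.smul_def]
  · rintro ⟨c, hc, rfl⟩
    refine ⟨fun q => ⟨c q, hc q⟩, ?_⟩
    rw [Finset.sum_range]
    simp [Subfield.smul_def]

end Operator

/-! ### Finite spans for the highest coefficients of approximate solutions. -/

section Candidates

variable {k : Type*} [Field k] {σ : k ≃+* k} {η : k}
  {solve : List k × List k → List (k × List k)}

/-- `solve` returns generators of the solution space of each nonzero equation. -/
def SpansSolutions (σ : k ≃+* k) (solve : List k × List k → List (k × List k)) : Prop :=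
  ∀ a b : List k, (∃ x ∈ a, x ≠ 0) →
    Submodule.span (constField σ) (Set.range fun i : Fin (solve (a, b)).length =>
      toVector b.length ((solve (a, b)).get i)) = pldeSpace σ a b

theorem SpansSolutions.mem_span (hs : SpansSolutions σ solve) {a b : List k}
    (ha : ∃ x ∈ a, x ≠ 0) {g : k}
    (hg : applyOperator σ a g ∈ Submodule.span (constField σ) {u | u ∈ b}) :
    g ∈ Submodule.span (constField σ) {u | u ∈ (solve (a, b)).map Prod.fst} := by
  obtain ⟨c, hc, hsum⟩ := mem_span_list.1 hg
  have h₁ : (g, fun j : Fin b.length => c j) ∈ pldeSpace σ a b := by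
    refine ⟨fun j => hc j, ?_⟩
    change applyOperator σ a g = ∑ j : Fin b.length, c j * b.get j
    rw [hsum, Finset.sum_range]
    simp
  rw [← hs a b ha] at h₁
  have h₂ := Submodule.mem_map_of_mem (f := LinearMap.fst (constField σ) k (Fin b.length → k)) h₁
  rw [Submodule.map_span] at h₂
  refine Submodule.span_mono ?_ h₂
  rintro _ ⟨_, ⟨i, rfl⟩, rfl⟩
  exact List.mem_map.2 ⟨_, List.get_mem _ i, rfl⟩

theorem symbol_mem_symbolList (a : List (List k)) (N : ℕ) {r s b : ℕ} {U : List k} {u : k}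
    (hu : u ∈ U) (hs : s < r) (hb : b < r) :
    symbol σ η a N s b u ∈ symbolList σ η a N r U := by
  obtain ⟨q, hq, rfl⟩ := List.mem_iff_getElem.1 hu
  refine List.mem_map.2 ⟨Nat.pair q (Nat.pair s b), List.mem_range.2 ?_, ?_⟩
  · have h₁ := Nat.pair_lt_max_add_one_sq s b
    have h₂ := Nat.pair_lt_max_add_one_sq q (Nat.pair s b)
    have h₃ : (max s b + 1) ^ 2 ≤ r ^ 2 := Nat.pow_le_pow_left (by omega) 2
    exact h₂.trans_le (Nat.pow_le_pow_left (by omega) 2)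
  · simp [List.getD_eq_getElem?_getD, hq]

theorem candidates_mono (a : List (List k)) (N : ℕ) :
    Monotone fun r => {u | u ∈ candidates σ η solve a N r} :=
  monotone_nat_of_le_succ fun _ _ hu => List.mem_append_left _ hu

/-- Row `r` is an equation over `k` for `z r` with right side built from earlier `z i`. The weights
`β` (binomials in the application) are natural numbers, hence constants, and do not affect spans;
this is why the candidates do not depend on the degree. -/
theorem mem_span_candidates (hs : SpansSolutions σ solve) {a : List (List k)} {N : ℕ}
    (hN : ∀ i < a.length, ∀ m, N < m → coeffAt a i m = 0)
    (hlead : ¬ ∀ i < a.length, coeffAt a i N = 0) {z : ℕ → k} {j : ℕ} {β : ℕ → ℕ → ℕ}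
    (hβ : ∀ i, β i 0 = 1)
    (hz : ∀ r ≤ j, ∑ i ∈ Finset.range (r + 1), ∑ b ∈ Finset.range (j + 1),
      (β i b : k) * symbol σ η a N (r - i) b (z i) = 0) (r : ℕ) (hr : r ≤ j) :
    z r ∈ Submodule.span (constField σ) {u | u ∈ candidates σ η solve a N r} := by
  have hl : ∃ x ∈ leadList a N, x ≠ 0 := by
    push Not at hlead
    obtain ⟨i, hi, h⟩ := hlead
    exact ⟨_, List.mem_map.2 ⟨i, List.mem_range.2 hi, rfl⟩, h⟩
  induction r using Nat.strong_induction_on with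
  | _ r ih =>
    have h₁ := hz r hr
    -- For `i = r` only `b = 0` survives, with weight 1.
    have h₂ : ∑ b ∈ Finset.range (j + 1), (β r b : k) * symbol σ η a N (r - r) b (z r) =
        applyOperator σ (leadList a N) (z r) := by
      rw [applyOperator_leadList (η := η), Finset.sum_eq_single 0]
      · simp [hβ]
      · intro b _ hb
        rw [symbol_eq_zero hN (by omega), mul_zero]
      · simp
    rw [Finset.sum_range_succ, h₂] at h₁
    rcases r with _ | r
    · refine hs.mem_span hl ?_
      rw [Finset.range_zero, Finset.sum_empty, zero_add] at h₁
      rw [h₁]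
      exact zero_mem _
    · refine Submodule.span_mono (fun u hu => List.mem_append_right _ hu) (hs.mem_span hl
        (b := symbolList σ η a N (r + 2) (candidates σ η solve a N r)) ?_)
      rw [eq_neg_of_add_eq_zero_right h₁]
      refine neg_mem (sum_mem fun i hi => sum_mem fun b _ => ?_)
      have hir := Finset.mem_range.1 hi
      rw [← nsmul_eq_mul]
      refine nsmul_mem ?_ _
      rcases lt_or_ge (r + 1 - i) b with hb | hb
      · rw [symbol_eq_zero hN hb]
        exact zero_mem _
      · have h₃ := Submodule.span_mono (candidates_mono (σ := σ) (η := η) (solve := solve) a N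
          (show i ≤ r by omega)) (ih i (by omega) (by omega))
        have h₄ := Submodule.mem_map_of_mem (f := symbolLinear σ η a N (r + 1 - i) b) h₃
        rw [Submodule.map_span] at h₄
        refine Submodule.span_mono ?_ h₄
        rintro _ ⟨u, hu, rfl⟩
        exact symbol_mem_symbolList a N hu (by omega) (by omega)

end Candidates

/-! ### The system as a matrix of polynomials, and soundness of certificates. -/

section RowPoly

variable {k : Type*} [Field k]

/-- The polynomial with value `binom(x + c, b)` at each `x ∈ ℕ`. -/
noncomputable def choosePoly (k : Type*) [Field k] (c b : ℕ) : k[X] :=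
  C ((b.factorial : k)⁻¹) * (descPochhammer k b).comp (X + (c : k[X]))

theorem eval_choosePoly [CharZero k] (c b x : ℕ) :
    (choosePoly k c b).eval (x : k) = ((x + c).choose b : k) := by
  have h : (b.factorial : k) ≠ 0 := by exact_mod_cast b.factorial_ne_zero
  rw [choosePoly, eval_mul, eval_C, eval_comp, eval_add, eval_X, eval_natCast, ← Nat.cast_add,
    descPochhammer_eval_eq_descFactorial, Nat.descFactorial_eq_factorial_mul_choose, Nat.cast_mul,
    inv_mul_cancel_left₀ h]

theorem natDegree_choosePoly_le (c b : ℕ) : (choosePoly k c b).natDegree ≤ b := by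
  refine natDegree_C_mul_le _ _ |>.trans ?_
  rw [natDegree_comp, descPochhammer_natDegree, ← C_eq_natCast, natDegree_X_add_C, mul_one]

theorem map_choosePoly (σ : k ≃+* k) (c b : ℕ) :
    (choosePoly k c b).map (σ : k →+* k) = choosePoly k c b := by
  simp [choosePoly, Polynomial.map_mul, Polynomial.map_comp, descPochhammer_map]

/-- The polynomial with value `∑_{m<n} l_m x^m` at each `x ∈ ℕ`. -/
noncomputable def polyOfFun (l : ℕ → k) (n : ℕ) : k[X] := ∑ m ∈ Finset.range n, C (l m) * X ^ m

theorem eval_polyOfFun (l : ℕ → k) (n x : ℕ) : (polyOfFun l n).eval (x : k) = evalList l n x := by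
  simp [polyOfFun, evalList, eval_finsetSum]

theorem natDegree_polyOfFun_lt (l : ℕ → k) {n : ℕ} (hn : 0 < n) :
    (polyOfFun l n).natDegree < n := by
  refine lt_of_le_of_lt (natDegree_sum_le_of_forall_le (n := n - 1) _ _ fun m hm => ?_) (by omega)
  have := Finset.mem_range.1 hm
  exact (natDegree_C_mul_X_pow_le _ _).trans (by omega)

theorem polyOfFun_coeff {p : k[X]} {n : ℕ} (hp : p.natDegree < n) : polyOfFun p.coeff n = p :=
  (p.as_sum_range_C_mul_X_pow' hp).symm

theorem polyOfFun_getD (l : List k) : polyOfFun (fun m => l.getD m 0) l.length = polyOfList l := by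
  ext m
  rw [coeff_polyOfList, polyOfFun, finsetSum_coeff]
  simp only [coeff_C_mul_X_pow]
  rw [Finset.sum_ite_eq]
  split_ifs with h
  · rfl
  · rw [List.getD_eq_default _ _ (by simpa using h)]

variable (σ : k ≃+* k) (η : k) (solve : List k × List k → List (k × List k))

/-- The polynomial with value `σ^e(rowEntry σ η solve a N j r i q x)` at each `x ∈ ℕ`. -/
noncomputable def rowPoly (a : List (List k)) (N j e r i q : ℕ) : k[X] :=
  if i ≤ r then
    ∑ b ∈ Finset.range (j + 1), choosePoly k (j - i) b *
      C ((⇑σ)^[e] (symbol σ η a N (r - i) b ((candidates σ η solve a N i).getD q 0)))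
  else 0

variable {σ} {η} {solve}

theorem eval_rowPoly [CharZero k] (a : List (List k)) (N j e r i q x : ℕ) :
    (rowPoly σ η solve a N j e r i q).eval (x : k) =
      (⇑σ)^[e] (rowEntry σ η solve a N j r i q x) := by
  rw [rowPoly, rowEntry]
  split_ifs
  · simp only [eval_finsetSum, eval_mul, eval_C, eval_choosePoly, ← RingAut.coe_pow, map_sum,
      map_mul, map_natCast]
  · simp [iterate_map_zero]

theorem natDegree_rowPoly_le (a : List (List k)) (N j e r i q : ℕ) :
    (rowPoly σ η solve a N j e r i q).natDegree ≤ j := by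
  rw [rowPoly]
  split_ifs
  · refine natDegree_sum_le_of_forall_le _ _ fun b hb => ?_
    exact (natDegree_mul_C_le _ _).trans ((natDegree_choosePoly_le _ _).trans
      (Nat.lt_succ_iff.1 (Finset.mem_range.1 hb)))
  · simp

/-- The binomial polynomials have rational coefficients and are fixed by `σ`. This makes the row
module stable under `σ`. -/
theorem map_rowPoly (a : List (List k)) (N j e r i q : ℕ) :
    (rowPoly σ η solve a N j e r i q).map (σ : k →+* k) =
      rowPoly σ η solve a N j (e + 1) r i q := by
  rw [rowPoly, rowPoly]
  split_ifs
  · simp only [Polynomial.map_sum, Polynomial.map_mul, map_choosePoly, map_C,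
      Function.iterate_succ_apply']
    rfl
  · simp

/-- The finitely many checks suffice: the difference of the sides is a polynomial in `x` with more
roots than its degree, as natural numbers stay distinct in characteristic 0. -/
theorem IsCertificate.identity_forall [CharZero k] {a : List (List k)} {c : ℕ × ℕ × List k × List k}
    (h : IsCertificate σ η solve a c) (x : ℕ) {q i q' : ℕ}
    (hq : q < (candidates σ η solve a c.1 0).length) (hi : i < a.length + 1)
    (hq' : q' < (candidates σ η solve a c.1 i).length) :
    (if Nat.pair i q' = Nat.pair 0 q then (polyOfList c.2.2.1).eval (x : k) else 0) =
      ∑ r ∈ Finset.range (a.length + 1), ∑ e ∈ Finset.range c.2.1,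
        evalList (fun m => c.2.2.2.getD (Nat.pair q (Nat.pair r (Nat.pair e m))) 0) c.2.1 x *
          (⇑σ)^[e] (rowEntry σ η solve a c.1 a.length r i q' x) := by
  have hD : 0 < c.2.1 := by
    refine lt_of_lt_of_le (Nat.pos_of_ne_zero fun h₀ => h.ne_zero ?_) h.length_le
    intro i hi
    omega
  set P : k[X] := (if Nat.pair i q' = Nat.pair 0 q then polyOfList c.2.2.1 else 0) -
    ∑ r ∈ Finset.range (a.length + 1), ∑ e ∈ Finset.range c.2.1,
      polyOfFun (fun m => c.2.2.2.getD (Nat.pair q (Nat.pair r (Nat.pair e m))) 0) c.2.1 *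
        rowPoly σ η solve a c.1 a.length e r i q' with hP
  have heval : ∀ x : ℕ, P.eval (x : k) =
      (if Nat.pair i q' = Nat.pair 0 q then (polyOfList c.2.2.1).eval (x : k) else 0) -
      ∑ r ∈ Finset.range (a.length + 1), ∑ e ∈ Finset.range c.2.1,
        evalList (fun m => c.2.2.2.getD (Nat.pair q (Nat.pair r (Nat.pair e m))) 0) c.2.1 x *
          (⇑σ)^[e] (rowEntry σ η solve a c.1 a.length r i q' x) := fun x => by
    simp only [hP, eval_sub, eval_finsetSum, eval_mul, eval_polyOfFun, eval_rowPoly]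
    congr 1
    split_ifs <;> simp
  have hdeg : P.natDegree ≤ c.2.1 - 1 + a.length := by
    refine (natDegree_sub_le _ _).trans (max_le ?_ ?_)
    · have := natDegree_polyOfList_lt hD h.length_le
      split_ifs
      · omega
      · simp
    · refine natDegree_sum_le_of_forall_le _ _ fun r _ =>
        natDegree_sum_le_of_forall_le _ _ fun e _ =>
          natDegree_mul_le_of_le ?_ (natDegree_rowPoly_le a c.1 a.length e r i q')
      have := natDegree_polyOfFun_lt (fun m => c.2.2.2.getD (Nat.pair q (Nat.pair r
        (Nat.pair e m))) (0 : k)) hD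
      omega
  have hzero : P = 0 := by
    classical
    refine eq_zero_of_natDegree_lt_card_of_eval_eq_zero' P
      ((Finset.range (c.2.1 + a.length)).image fun x : ℕ => (x : k)) ?_ ?_
    · intro y hy
      obtain ⟨x, hx, rfl⟩ := Finset.mem_image.1 hy
      have := h.identity x (Finset.mem_range.1 hx) q hq i hi q' hq'
      rw [← eval_polyOfFun, polyOfFun_getD] at this
      rw [heval, this, sub_self]
    · rw [Finset.card_image_of_injective _ Nat.cast_injective, Finset.card_range]
      omega
  have := heval x
  rw [hzero, eval_zero] at this
  exact (sub_eq_zero.1 this.symm)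

theorem IsCertificate.coeff_le {a : List (List k)} {c : ℕ × ℕ × List k × List k}
    (h : IsCertificate σ η solve a c) {i m : ℕ} (hi : i < a.length) (hm : c.1 < m) :
    coeffAt a i m = 0 := by
  rcases lt_or_ge m (a.getD i []).length with h' | h'
  · exact (h.degree_le i hi m h').resolve_left (by omega)
  · exact List.getD_eq_default _ _ h'

theorem sum_symbol_eq_sum_rowEntry (a : List (List k)) (N : ℕ) {c : ℕ → ℕ → k}
    (hc : ∀ i q, c i q ∈ constField σ) (x : ℕ) {j r : ℕ} (hr : r ≤ j) :
    ∑ i ∈ Finset.range (r + 1), ∑ b ∈ Finset.range (j + 1),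
      ((x + j - i).choose b : k) * symbol σ η a N (r - i) b
        (∑ q ∈ Finset.range (candidates σ η solve a N i).length,
          c i q * (candidates σ η solve a N i).getD q 0) =
    ∑ i ∈ Finset.range (j + 1), ∑ q ∈ Finset.range (candidates σ η solve a N i).length,
      c i q * rowEntry σ η solve a N j r i q x := by
  rw [← Finset.sum_subset (Finset.range_mono (show r + 1 ≤ j + 1 by omega))]
  · refine Finset.sum_congr rfl fun i hi => ?_
    have hir : i ≤ r := Nat.lt_succ_iff.1 (Finset.mem_range.1 hi)
    simp only [rowEntry, if_pos hir, ← symbolLinear_apply, map_sum, Finset.mul_sum]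
    rw [Finset.sum_comm]
    refine Finset.sum_congr rfl fun q _ => Finset.sum_congr rfl fun b _ => ?_
    have h₁ := (symbolLinear σ η a N (r - i) b).map_smul ⟨c i q, hc i q⟩
      ((candidates σ η solve a N i).getD q 0)
    simp only [Subfield.smul_def, smul_eq_mul] at h₁
    rw [h₁, show x + (j - i) = x + j - i by omega]
    ring
  · intro i _ hi
    refine Finset.sum_eq_zero fun q _ => ?_
    rw [rowEntry, if_neg fun h => hi (Finset.mem_range.2 (Nat.lt_succ_of_le h)), mul_zero]

/-- Approximate solutions exist only at the roots of the polynomial of the certificate. -/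
theorem IsCertificate.eval_eq_zero [CharZero k] (hs : SpansSolutions σ solve) {a : List (List k)}
    {c : ℕ × ℕ × List k × List k} (h : IsCertificate σ η solve a c) {y : k[X]} (hy : y ≠ 0) {x : ℕ}
    (hx : y.natDegree = x + a.length)
    (hcoeff : ∀ r ≤ a.length, (polyOperator σ η a y).coeff (y.natDegree + c.1 - r) = 0) :
    (polyOfList c.2.2.1).eval (x : k) = 0 := by
  by_contra hp
  set j := a.length with hj
  have hN : ∀ i < a.length, ∀ m, c.1 < m → coeffAt a i m = 0 := fun i hi m hm => h.coeff_le hi hm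
  set z : ℕ → k := fun i => y.coeff (x + j - i) with hz
  have heq : ∀ r ≤ j, ∑ i ∈ Finset.range (r + 1), ∑ b ∈ Finset.range (j + 1),
      ((x + j - i).choose b : k) * symbol σ η a c.1 (r - i) b (z i) = 0 := fun r hr => by
    have := hcoeff r hr
    rwa [coeff_polyOperator hN le_rfl hr (by omega), hx] at this
  have hspan := mem_span_candidates hs hN h.lead (fun i => Nat.choose_zero_right _) heq
  simp only [mem_span_list] at hspan
  have hspan' : ∀ r, ∃ c' : ℕ → k, (∀ q, c' q ∈ constField σ) ∧ (r ≤ j → z r =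
      ∑ q ∈ Finset.range (candidates σ η solve a c.1 r).length,
        c' q * (candidates σ η solve a c.1 r).getD q 0) := fun r => by
    by_cases hr : r ≤ j
    · obtain ⟨c', h₁, h₂⟩ := hspan r hr
      exact ⟨c', h₁, fun _ => h₂⟩
    · exact ⟨0, fun _ => zero_mem _, fun h => absurd h hr⟩
  choose c' hc' hzc using hspan'
  have hrow : ∀ r ≤ j, ∑ i ∈ Finset.range (j + 1),
      ∑ q ∈ Finset.range (candidates σ η solve a c.1 i).length,
        c' i q * rowEntry σ η solve a c.1 j r i q x = 0 := fun r hr => by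
    rw [← sum_symbol_eq_sum_rowEntry a c.1 hc' x hr]
    refine Eq.trans ?_ (heq r hr)
    refine Finset.sum_congr rfl fun i hi => ?_
    rw [hzc i (by have := Finset.mem_range.1 hi; omega)]
  -- The `c'` are constants, so they annihilate every `σ^e`-transform of the rows, hence also the
  -- combination in the certificate, which equals `p(x)` times the unit vector at `(0, q)`.
  have hc₀ : ∀ q < (candidates σ η solve a c.1 0).length, c' 0 q = 0 := fun q hq => by
    have h₁ : ∑ i ∈ Finset.range (j + 1),
        ∑ q' ∈ Finset.range (candidates σ η solve a c.1 i).length, c' i q' *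
          (if Nat.pair i q' = Nat.pair 0 q then (polyOfList c.2.2.1).eval (x : k) else 0) = 0 := by
      rw [Finset.sum_congr rfl fun i hi => Finset.sum_congr rfl fun q' hq' => by
        rw [h.identity_forall x hq (Finset.mem_range.1 hi) (Finset.mem_range.1 hq')]]
      have h₂ : ∀ r ≤ j, ∀ e, ∑ i ∈ Finset.range (j + 1),
          ∑ q' ∈ Finset.range (candidates σ η solve a c.1 i).length,
            c' i q' * (⇑σ)^[e] (rowEntry σ η solve a c.1 j r i q' x) = 0 := fun r hr e => by
        have := congrArg (⇑σ)^[e] (hrow r hr)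
        simp only [← RingAut.coe_pow, map_sum, map_mul, map_zero] at this
        simp only [RingAut.coe_pow, iterate_constField _ (hc' _ _)] at this
        exact this
      rw [Finset.sum_sigma']
      simp only [Finset.mul_sum]
      rw [Finset.sum_comm]
      refine Finset.sum_eq_zero fun r hr => ?_
      rw [Finset.sum_comm]
      refine Finset.sum_eq_zero fun e _ => ?_
      have h₃ := h₂ r (Nat.lt_succ_iff.1 (Finset.mem_range.1 hr)) e
      rw [Finset.sum_sigma'] at h₃
      simp only [mul_left_comm (c' _ _)]
      rw [← Finset.mul_sum, h₃, mul_zero]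
    rw [Finset.sum_eq_single_of_mem 0 (by simp), Finset.sum_eq_single_of_mem q (by simpa using hq),
      if_pos rfl] at h₁
    · exact (mul_eq_zero.1 h₁).resolve_right hp
    · intro q' _ hne
      rw [if_neg fun h => hne (Nat.pair_eq_pair.1 h).2, mul_zero]
    · intro i _ hne
      exact Finset.sum_eq_zero fun q' _ => by
        rw [if_neg fun h => hne (Nat.pair_eq_pair.1 h).1, mul_zero]
  refine hy (leadingCoeff_eq_zero.1 ?_)
  have : z 0 = y.leadingCoeff := by simp only [hz, leadingCoeff, hx, Nat.sub_zero]
  rw [← this, hzc 0 (Nat.zero_le _)]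
  exact Finset.sum_eq_zero fun q hq => by rw [hc₀ q (Finset.mem_range.1 hq), zero_mul]

end RowPoly

/-! ### Descent to fixed vectors, and functionals over a principal ideal domain. -/

section LinearAlgebra

/-- A subspace that is stable under a field automorphism contains vectors with fixed
coordinates. -/
theorem exists_fixed_mem {F ι : Type*} [Field F] [Fintype ι] (V : Submodule F (ι → F))
    (ρ : F ≃+* F) (hV : ∀ v ∈ V, (fun i => ρ (v i)) ∈ V) {v : ι → F} (hv : v ∈ V) {q : ι}
    (hq : v q ≠ 0) : ∃ c ∈ V, c q ≠ 0 ∧ ∀ i, ρ (c i) = c i := by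
  classical
  suffices h : ∀ n, ∀ v ∈ V, v q = 1 → (Finset.univ.filter fun i => v i ≠ 0).card = n →
      ∃ c ∈ V, c q ≠ 0 ∧ ∀ i, ρ (c i) = c i from
    h _ ((v q)⁻¹ • v) (V.smul_mem _ hv) (by simp [hq]) rfl
  intro n
  induction n using Nat.strong_induction_on with
  | _ n ih =>
    intro v hv hq hn
    by_cases hfix : ∀ i, ρ (v i) = v i
    · exact ⟨v, hv, by simp [hq], hfix⟩
    push Not at hfix
    obtain ⟨r, hr⟩ := hfix
    set w : ι → F := (fun i => ρ (v i)) - v with hw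
    have hwV : w ∈ V := V.sub_mem (hV v hv) hv
    have hwr : w r ≠ 0 := sub_ne_zero.2 hr
    have hvr : v r ≠ 0 := fun h => hr (by rw [h, map_zero])
    -- `w` vanishes wherever `v` does, and also at `q` because `v q = 1`. The new vector keeps the
    -- entry 1 at `q`, loses the entry at `r`, and so has smaller support.
    refine ih _ ?_ (v - (v r / w r) • w) (V.sub_mem hv (V.smul_mem _ hwV)) ?_ rfl
    · rw [← hn]
      refine Finset.card_lt_card ((Finset.ssubset_iff_of_subset fun i => ?_).2 ⟨r, ?_, ?_⟩)
      · simp only [Finset.mem_filter_univ]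
        intro hi h
        exact hi (by simp [hw, h])
      · simpa using hvr
      · simp [hwr]
    · simp [hw, hq]

/-- The quotient by `S`, taken modulo torsion, is finitely generated and torsion-free, hence free;
functionals therefore detect every class that is not torsion. -/
theorem exists_smul_mem_or_exists_dual {R M : Type*} [CommRing R] [IsDomain R]
    [IsPrincipalIdealRing R] [AddCommGroup M] [Module R M] [Module.Finite R M]
    (S : Submodule R M) (m : M) :
    (∃ p : R, p ≠ 0 ∧ p • m ∈ S) ∨ ∃ φ : M →ₗ[R] R, (∀ s ∈ S, φ s = 0) ∧ φ m ≠ 0 := by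
  by_cases h : S.mkQ m ∈ Submodule.torsion R (M ⧸ S)
  · left
    obtain ⟨p, hp⟩ := (Submodule.mem_torsion_iff _).1 h
    refine ⟨p, nonZeroDivisors.coe_ne_zero p, ?_⟩
    rwa [Submonoid.smul_def, ← map_smul, Submodule.mkQ_apply, Submodule.Quotient.mk_eq_zero] at hp
  · right
    have h₁ : (Submodule.torsion R (M ⧸ S)).mkQ (S.mkQ m) ≠ 0 := by
      rwa [Submodule.mkQ_apply, ne_eq, Submodule.Quotient.mk_eq_zero]
    have h₂ : ¬ ∀ φ : Module.Dual R ((M ⧸ S) ⧸ Submodule.torsion R (M ⧸ S)),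
        φ ((Submodule.torsion R (M ⧸ S)).mkQ (S.mkQ m)) = 0 := fun h =>
      h₁ ((Module.forall_dual_apply_eq_zero_iff R _).1 h)
    push Not at h₂
    obtain ⟨φ, hφ⟩ := h₂
    refine ⟨φ ∘ₗ (Submodule.torsion R (M ⧸ S)).mkQ ∘ₗ S.mkQ, fun s hs => ?_, hφ⟩
    have : S.mkQ s = 0 := by rwa [Submodule.mkQ_apply, Submodule.Quotient.mk_eq_zero]
    simp [-Submodule.mkQ_apply, this]

end LinearAlgebra

/-! ### Approximate solutions cannot exist in all large degrees. -/

section Existence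

variable {k : Type*} [Field k] {σ : k ≃+* k} {η : k}

theorem natDegree_polyShift_iterate (p : k[X]) (i : ℕ) :
    ((polyShift σ η)^[i] p).natDegree = p.natDegree := by
  induction i with
  | zero => rfl
  | succ i ih => rw [Function.iterate_succ_apply', natDegree_polyShift, ih]

theorem natDegree_polyOperator_le {a : List (List k)} {N : ℕ}
    (hN : ∀ i < a.length, ∀ m, N < m → coeffAt a i m = 0) (y : k[X]) :
    (polyOperator σ η a y).natDegree ≤ y.natDegree + N := by
  refine natDegree_sum_le_of_forall_le _ _ fun i hi => ?_
  rw [add_comm]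
  refine natDegree_mul_le_of_le ?_ (natDegree_polyShift_iterate y i).le
  refine natDegree_le_iff_coeff_eq_zero.2 fun m hm => ?_
  rw [coeff_polyOfList]
  exact hN i (Finset.mem_range.1 hi) m hm

theorem algebraMap_polyOperator (a : List (List k)) (y : k[X]) :
    algebraMap k[X] (RatFunc k) (polyOperator σ η a y) =
      ∑ i ∈ Finset.range a.length, algebraMap k[X] (RatFunc k) (polyOfList (a.getD i [])) *
        (ratFuncShift σ η)^[i] (algebraMap k[X] (RatFunc k) y) := by
  have h : ∀ i, (ratFuncShift σ η)^[i] (algebraMap k[X] (RatFunc k) y) =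
      algebraMap k[X] (RatFunc k) ((polyShift σ η)^[i] y) := fun i => by
    induction i with
    | zero => rfl
    | succ i ih => rw [Function.iterate_succ_apply', ih, ratFuncShift_algebraMap,
        Function.iterate_succ_apply']
  simp only [polyOperator, map_sum, map_mul, h]

/-- There cannot be approximate solutions of all large degrees. -/
theorem not_forall_approximate_solution [CharZero k] (hη : ∀ g : k, σ g - g ≠ η)
    {a : List (List k)} {N : ℕ} (hN : ∀ i < a.length, ∀ m, N < m → coeffAt a i m = 0)
    (hlead : ¬ ∀ i < a.length, coeffAt a i N = 0) (x₀ : ℕ) :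
    ¬ ∀ x ≥ x₀, ∃ y : k[X], y ≠ 0 ∧ y.natDegree = x + a.length ∧
      ∀ r ≤ a.length, (polyOperator σ η a y).coeff (x + a.length + N - r) = 0 := by
  intro h
  push Not at hlead
  obtain ⟨i₀, hi₀, hne⟩ := hlead
  obtain ⟨n, hn⟩ : ∃ n, a.length = n + 1 := ⟨a.length - 1, by omega⟩
  -- Steps of `n + 1` in the degree provide the gaps that `exists_le_map_operator` needs.
  choose y hy hdeg hcoeff using fun s => h (x₀ + s * (n + 1)) (Nat.le_add_right _ _)
  have hd := isDifferenceDegree_intDegree hη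
  have hf : ∀ s, algebraMap k[X] (RatFunc k) (y s) ≠ 0 := fun s =>
    RatFunc.algebraMap_ne_zero (hy s)
  have hdf : ∀ s, RatFunc.intDegree (algebraMap k[X] (RatFunc k) (y s)) =
      (x₀ + s * (n + 1) + (n + 1) : ℕ) := fun s => by
    rw [RatFunc.intDegree_polynomial, hdeg, hn]
  obtain ⟨s, -, hs, hs'⟩ := hd.exists_le_map_operator n
    (fun s => algebraMap k[X] (RatFunc k) (y s))
    (fun i => algebraMap k[X] (RatFunc k) (polyOfList (a.getD i []))) N (fun s _ => hf s)
    (fun s _ s' hs' => by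
      rw [hdf, hdf]
      have : (s' + 1) * (n + 1) ≤ s * (n + 1) := Nat.mul_le_mul_right _ hs'
      rw [add_mul, one_mul] at this
      push_cast
      zify at this
      linarith)
    ⟨i₀, by omega, by
      have h₁ : (polyOfList (a.getD i₀ [])).coeff N ≠ 0 := by
        rw [coeff_polyOfList]
        exact hne
      refine ⟨RatFunc.algebraMap_ne_zero fun h₀ => h₁ (by rw [h₀, coeff_zero]), ?_⟩
      rw [RatFunc.intDegree_polynomial]
      exact_mod_cast le_natDegree_of_ne_zero h₁⟩
  rw [← hn, ← algebraMap_polyOperator] at hs hs'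
  rw [hdf, RatFunc.intDegree_polynomial] at hs'
  have hP : polyOperator σ η a (y s) ≠ 0 := fun h₀ => hs (by rw [h₀, map_zero])
  have h₁ := natDegree_polyOperator_le (σ := σ) (η := η) hN (y s)
  rw [hdeg] at h₁
  -- The image of `y s` has degree at least `deg (y s) + N - n`, so its leading coefficient is among
  -- those assumed to vanish.
  have h₂ := hcoeff s (x₀ + s * (n + 1) + a.length + N - (polyOperator σ η a (y s)).natDegree)
    (by omega)
  rw [Nat.sub_sub_self h₁] at h₂
  exact hP (leadingCoeff_eq_zero.1 h₂)

theorem exists_max_coeffAt {a : List (List k)} (ha : ∃ p ∈ a, polyOfList p ≠ 0) :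
    ∃ N, (∀ i < a.length, ∀ m, N < m → coeffAt a i m = 0) ∧
      ¬ ∀ i < a.length, coeffAt a i N = 0 := by
  set S : Set ℕ := {m | ∃ i < a.length, coeffAt a i m ≠ 0} with hS
  have hbdd : BddAbove S := by
    refine ⟨∑ i ∈ Finset.range a.length, (a.getD i []).length, ?_⟩
    rintro m ⟨i, hi, hm⟩
    have h₁ : m < (a.getD i []).length := by
      by_contra h
      exact hm (List.getD_eq_default _ _ (not_lt.1 h))
    exact h₁.le.trans (Finset.single_le_sum (f := fun i => (a.getD i []).length)
      (fun _ _ => Nat.zero_le _) (Finset.mem_range.2 hi))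
  have hne : S.Nonempty := by
    obtain ⟨p, hp, hp₀⟩ := ha
    obtain ⟨i, hi, rfl⟩ := List.mem_iff_getElem.1 hp
    refine ⟨(polyOfList a[i]).natDegree, i, hi, ?_⟩
    have := leadingCoeff_ne_zero.2 hp₀
    rw [leadingCoeff, coeff_polyOfList] at this
    simpa [coeffAt, List.getD_eq_getElem?_getD, hi] using this
  refine ⟨sSup S, fun i hi m hm => ?_, fun h => ?_⟩
  · by_contra h
    exact absurd (le_csSup hbdd ⟨i, hi, h⟩) (not_le.2 hm)
  · obtain ⟨i, hi, h'⟩ := Nat.sSup_mem hne hbdd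
    exact h' (h i hi)

end Existence

/-! ### The row module contains multiples of the unit vectors for the leading coefficient. -/

section Existence

variable {k : Type*} [Field k] {σ : k ≃+* k} {η : k}
  {solve : List k × List k → List (k × List k)}

/-- The candidates for the leading coefficient are linearly independent over the constants. -/
theorem candidates_zero_independent
    (hind : ∀ a b : List k, (∃ x ∈ a, x ≠ 0) →
      LinearIndependent (constField σ)
        (fun i : Fin (solve (a, b)).length => toVector b.length ((solve (a, b)).get i)))
    {a : List (List k)} {N : ℕ} (hlead : ¬ ∀ i < a.length, coeffAt a i N = 0) {c : ℕ → k}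
    (hc : ∀ q, c q ∈ constField σ)
    (h : ∑ q ∈ Finset.range (candidates σ η solve a N 0).length,
      c q * (candidates σ η solve a N 0).getD q 0 = 0) {q : ℕ}
    (hq : q < (candidates σ η solve a N 0).length) : c q = 0 := by
  have hl : ∃ x ∈ leadList a N, x ≠ 0 := by
    push Not at hlead
    obtain ⟨i, hi, h⟩ := hlead
    exact ⟨_, List.mem_map.2 ⟨i, List.mem_range.2 hi, rfl⟩, h⟩
  -- With an empty right side, the basis vectors consist of their first components only.
  have h₁ := Fintype.linearIndependent_iff.1 (hind _ [] hl) (fun i => ⟨c i, hc i⟩) ?_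
  · have hq' : q < (solve (leadList a N, [])).length := by simpa [candidates] using hq
    exact congrArg Subtype.val (h₁ ⟨q, hq'⟩)
  · refine Prod.ext ?_ (funext fun i => i.elim0)
    rw [candidates, List.length_map, Finset.sum_range] at h
    rw [Prod.fst_sum, Prod.fst_zero, ← h]
    refine Finset.sum_congr rfl fun i _ => ?_
    simp [toVector, Subfield.smul_def]

variable (σ η solve) in
/-- The row of the linear system for the unknowns `c_{i,q}` with index `r`, transformed by
`σ^e`. -/
noncomputable def rowVector (a : List (List k)) (N j : ℕ) (t : Fin (j + 1) × ℕ) :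
    (Σ i : Fin (j + 1), Fin (candidates σ η solve a N i).length) → k[X] :=
  fun i => rowPoly σ η solve a N j t.2 t.1 i.1 i.2

variable [CharZero k]

/-- A solution over `k` of all transformed rows at `x` can be replaced by a constant one. Expanding
it in the candidates gives the coefficients of `y`, and independence of the candidates at 0 keeps
the leading coefficient nonzero. -/
theorem exists_approximate_solution
    (hind : ∀ a b : List k, (∃ x ∈ a, x ≠ 0) →
      LinearIndependent (constField σ)
        (fun i : Fin (solve (a, b)).length => toVector b.length ((solve (a, b)).get i)))
    {a : List (List k)} {N : ℕ} (hN : ∀ i < a.length, ∀ m, N < m → coeffAt a i m = 0)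
    (hlead : ¬ ∀ i < a.length, coeffAt a i N = 0) {j x : ℕ}
    {v : (Σ i : Fin (j + 1), Fin (candidates σ η solve a N i).length) → k}
    {q : Fin (candidates σ η solve a N 0).length} (hq : v ⟨0, q⟩ ≠ 0)
    (hv : ∀ t, ∑ i, (rowVector σ η solve a N j t i).eval (x : k) * v i = 0) :
    ∃ y : k[X], y ≠ 0 ∧ y.natDegree = x + j ∧
      ∀ r ≤ j, (polyOperator σ η a y).coeff (x + j + N - r) = 0 := by
  let V : Submodule k ((Σ i : Fin (j + 1), Fin (candidates σ η solve a N i).length) → k) :=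
    { carrier := {v | ∀ t, ∑ i, (rowVector σ η solve a N j t i).eval (x : k) * v i = 0}
      zero_mem' := fun t => by simp
      add_mem' := fun {u w} hu hw t => by
        simp only [Pi.add_apply, mul_add, Finset.sum_add_distrib, hu t, hw t, add_zero]
      smul_mem' := fun c w hw t => by
        simp only [Pi.smul_apply, smul_eq_mul, mul_left_comm _ c, ← Finset.mul_sum, hw t,
          mul_zero] }
  -- `σ⁻¹` takes row `e + 1` to row `e`, so stability under it is immediate; applying `σ` instead
  -- would not reach the rows with `e = 0`.
  obtain ⟨c, hcV, hc₀, hfix⟩ := exists_fixed_mem V σ.symm (fun w hw t => by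
    have h₁ := congrArg σ.symm (hw (t.1, t.2 + 1))
    simp only [map_sum, map_mul, map_zero, rowVector, eval_rowPoly, Function.iterate_succ_apply',
      RingEquiv.symm_apply_apply] at h₁
    simpa only [rowVector, eval_rowPoly] using h₁) (show v ∈ V from hv) hq
  set c' : ℕ → ℕ → k := fun i q => if hi : i < j + 1 then
    if hq : q < (candidates σ η solve a N i).length then c ⟨⟨i, hi⟩, ⟨q, hq⟩⟩ else 0 else 0 with hc'
  have hconst : ∀ i q, c' i q ∈ constField σ := fun i q => by
    simp only [hc']
    split_ifs with hi hq
    · change σ _ = _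
      conv_lhs => rw [← hfix]
      exact σ.apply_symm_apply _
    · exact zero_mem _
    · exact zero_mem _
  have hrow : ∀ r ≤ j, ∑ i ∈ Finset.range (j + 1),
      ∑ q ∈ Finset.range (candidates σ η solve a N i).length,
        c' i q * rowEntry σ η solve a N j r i q x = 0 := fun r hr => by
    have h₁ := hcV (⟨r, Nat.lt_succ_of_le hr⟩, 0)
    rw [Fintype.sum_sigma] at h₁
    rw [Finset.sum_range, ← h₁]
    refine Finset.sum_congr rfl fun i _ => ?_
    rw [Finset.sum_range]
    refine Finset.sum_congr rfl fun q _ => ?_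
    have h₂ : c' i q = c ⟨i, q⟩ := by simp only [hc', dif_pos i.2, dif_pos q.2]
    simp [h₂, rowVector, eval_rowPoly, mul_comm]
  set z : ℕ → k := fun i => ∑ q ∈ Finset.range (candidates σ η solve a N i).length,
    c' i q * (candidates σ η solve a N i).getD q 0 with hz
  have hz₀ : z 0 ≠ 0 := fun h => by
    have h₁ := candidates_zero_independent hind hlead (hconst 0) h q.2
    simp only [hc', dif_pos (Nat.succ_pos j), dif_pos q.2] at h₁
    exact hc₀ h₁
  set y : k[X] := ∑ i ∈ Finset.range (j + 1), C (z i) * X ^ (x + j - i) with hy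
  have hcoeff : ∀ i ≤ j, y.coeff (x + j - i) = z i := fun i hi => by
    rw [hy, finsetSum_coeff, Finset.sum_eq_single_of_mem i (by simpa using Nat.lt_succ_of_le hi)]
    · simp
    · intro b hb hbi
      have := Finset.mem_range.1 hb
      rw [coeff_C_mul_X_pow, if_neg (by omega)]
  have hle : y.natDegree ≤ x + j := natDegree_sum_le_of_forall_le _ _ fun i _ =>
    (natDegree_C_mul_X_pow_le _ _).trans (Nat.sub_le _ _)
  have htop : y.coeff (x + j) ≠ 0 := by
    have := hcoeff 0 (Nat.zero_le _)
    rw [Nat.sub_zero] at this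
    rwa [this]
  refine ⟨y, fun h => htop (by rw [h, coeff_zero]), le_antisymm hle (le_natDegree_of_ne_zero htop),
    fun r hr => ?_⟩
  rw [coeff_polyOperator hN hle hr (Nat.le_add_left _ _), ← hrow r hr,
    ← sum_symbol_eq_sum_rowEntry a N hconst x hr]
  refine Finset.sum_congr rfl fun i hi => ?_
  rw [hcoeff i (by have := Finset.mem_range.1 hi; omega)]

/-- Otherwise a functional kills the row module but not the unit vector. Its values on the unit
vectors, evaluated at any `x` beyond finitely many roots, solve the system and give approximate
solutions of all large degrees. -/
theorem exists_smul_single_mem (hη : ∀ g : k, σ g - g ≠ η)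
    (hind : ∀ a b : List k, (∃ x ∈ a, x ≠ 0) →
      LinearIndependent (constField σ)
        (fun i : Fin (solve (a, b)).length => toVector b.length ((solve (a, b)).get i)))
    {a : List (List k)} {N : ℕ} (hN : ∀ i < a.length, ∀ m, N < m → coeffAt a i m = 0)
    (hlead : ¬ ∀ i < a.length, coeffAt a i N = 0)
    (q : Fin (candidates σ η solve a N 0).length) :
    ∃ p : k[X], p ≠ 0 ∧ p • Pi.single ⟨0, q⟩ 1 ∈
      Submodule.span k[X] (Set.range (rowVector σ η solve a N a.length)) := by
  refine (exists_smul_mem_or_exists_dual _ _).resolve_right ?_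
  rintro ⟨φ, hφ, hne⟩
  set v := fun i => φ (Pi.single i 1)
  have hφv : ∀ w, φ w = ∑ i, w i * v i := fun w => by
    rw [LinearMap.pi_apply_eq_sum_univ φ w]
    simp only [smul_eq_mul, v]
    refine Finset.sum_congr rfl fun i _ => ?_
    congr 2
    ext j
    simp [Pi.single_apply, eq_comm]
  have hfin : {x : ℕ | (v ⟨0, q⟩).eval (x : k) = 0}.Finite := by
    have h₁ : {y : k | (v ⟨0, q⟩).eval y = 0}.Finite := by
      classical
      exact ((v ⟨0, q⟩).roots.toFinset.finite_toSet).subset fun y hy => by simpa using ⟨hne, hy⟩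
    exact h₁.preimage (Nat.cast_injective.injOn)
  obtain ⟨x₀, hx₀⟩ := hfin.bddAbove
  refine not_forall_approximate_solution hη hN hlead (x₀ + 1) fun x hx => ?_
  refine exists_approximate_solution hind hN hlead (v := fun i => (v i).eval (x : k)) (q := q)
    (fun h => ?_) fun t => ?_
  · have := hx₀ h
    omega
  · have h₁ := hφv (rowVector σ η solve a N a.length t)
    rw [hφ _ (Submodule.subset_span ⟨t, rfl⟩)] at h₁
    have h₂ := congrArg (eval (x : k)) h₁.symm
    simpa [eval_finsetSum] using h₂

omit [CharZero k] in
theorem map_mem_span_rowVector (a : List (List k)) (N j : ℕ)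
    {w : (Σ i : Fin (j + 1), Fin (candidates σ η solve a N i).length) → k[X]}
    (hw : w ∈ Submodule.span k[X] (Set.range (rowVector σ η solve a N j))) :
    (fun i => (w i).map (σ : k →+* k)) ∈
      Submodule.span k[X] (Set.range (rowVector σ η solve a N j)) := by
  induction hw using Submodule.span_induction with
  | mem w hw =>
    obtain ⟨t, rfl⟩ := hw
    refine Submodule.subset_span ⟨(t.1, t.2 + 1), funext fun i => ?_⟩
    exact (map_rowPoly _ _ _ _ _ _ _).symm
  | zero =>
    simp only [Pi.zero_apply, Polynomial.map_zero]
    exact zero_mem _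
  | add u w _ _ hu hw =>
    convert add_mem hu hw using 1
    ext1 i
    simp
  | smul p w _ hw =>
    convert Submodule.smul_mem _ (p.map (σ : k →+* k)) hw using 1
    ext1 i
    simp

/-- There is a polynomial over the constants that maps all unit vectors for the leading
coefficient to the row space. -/
theorem exists_const_smul_single_mem (hη : ∀ g : k, σ g - g ≠ η)
    (hind : ∀ a b : List k, (∃ x ∈ a, x ≠ 0) →
      LinearIndependent (constField σ)
        (fun i : Fin (solve (a, b)).length => toVector b.length ((solve (a, b)).get i)))
    {a : List (List k)} {N : ℕ} (hN : ∀ i < a.length, ∀ m, N < m → coeffAt a i m = 0)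
    (hlead : ¬ ∀ i < a.length, coeffAt a i N = 0) :
    ∃ p : k[X], p ≠ 0 ∧ (∀ m, σ (p.coeff m) = p.coeff m) ∧
      ∀ q : Fin (candidates σ η solve a N 0).length, p • Pi.single ⟨0, q⟩ 1 ∈
        Submodule.span k[X] (Set.range (rowVector σ η solve a N a.length)) := by
  set S := Submodule.span k[X] (Set.range (rowVector σ η solve a N a.length))
  choose P hP hPS using exists_smul_single_mem hη hind hN hlead
  let I : Ideal k[X] := ⨅ q : Fin (candidates σ η solve a N 0).length,
    S.comap (LinearMap.toSpanSingleton k[X] _ (Pi.single ⟨0, q⟩ 1))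
  have hI : ∀ {p}, p ∈ I ↔ ∀ q : Fin (candidates σ η solve a N 0).length,
      p • Pi.single ⟨0, q⟩ 1 ∈ S := fun {p} => by
    simp only [I, Submodule.mem_iInf, Submodule.mem_comap, LinearMap.toSpanSingleton_apply]
  have hprod : ∏ q, P q ∈ I := hI.2 fun q => by
    obtain ⟨r, hr⟩ := Finset.dvd_prod_of_mem P (Finset.mem_univ q)
    rw [hr, mul_comm, mul_smul]
    exact S.smul_mem _ (hPS q)
  set g := Submodule.IsPrincipal.generator I
  have hg : g ∈ I := Submodule.IsPrincipal.generator_mem I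
  have hdvd : ∀ {p}, p ∈ I → g ∣ p := fun hp =>
    (Submodule.IsPrincipal.mem_iff_generator_dvd I).1 hp
  have hg₀ : g ≠ 0 := fun h₀ =>
    Finset.prod_ne_zero_iff.2 (fun q _ => hP q) (zero_dvd_iff.1 (h₀ ▸ hdvd hprod))
  set p := g * C g.leadingCoeff⁻¹ with hp
  have hmonic : p.Monic := monic_mul_leadingCoeff_inv hg₀
  have hpI : p ∈ I := I.mul_mem_right _ hg
  have hpdvd : ∀ {p'}, p' ∈ I → p ∣ p' := fun hp' => by
    rw [hp, (isUnit_C.2 (by simpa using hg₀)).mul_right_dvd]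
    exact hdvd hp'
  -- The ideal is stable under `σ`, so its monic generator divides its own image, which is monic of
  -- the same degree; the two coincide, and the coefficients are constants.
  have hmap : p.map (σ : k →+* k) ∈ I := hI.2 fun q => by
    convert map_mem_span_rowVector a N a.length (hI.1 hpI q) using 1
    ext1 i
    by_cases h : i = ⟨0, q⟩
    · subst h
      simp
    · simp [Pi.single_eq_of_ne h]
  have heq := eq_of_monic_of_dvd_of_natDegree_le hmonic (hmonic.map (σ : k →+* k)) (hpdvd hmap)
    (natDegree_map_le ..)
  refine ⟨p, hmonic.ne_zero, fun m => ?_, hI.1 hpI⟩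
  conv_rhs => rw [← heq]
  simp

end Existence

/-! ### Existence of certificates. -/

section Existence

variable {k : Type*} [Field k] {σ : k ≃+* k} {η : k}
  {solve : List k × List k → List (k × List k)}

theorem exists_list_getD_pair (f : ℕ → ℕ → ℕ → ℕ → k) (B : ℕ) :
    ∃ L : List k, ∀ q ≤ B, ∀ r ≤ B, ∀ e ≤ B, ∀ m ≤ B,
      L.getD (Nat.pair q (Nat.pair r (Nat.pair e m))) 0 = f q r e m := by
  have h : ∀ {A B x y : ℕ}, B ≤ A → x ≤ B → y ≤ A → Nat.pair x y ≤ (A + 1) ^ 2 :=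
    fun {A B x y} hBA hx hy => (Nat.pair_lt_max_add_one_sq x y).le.trans
      (Nat.pow_le_pow_left (by omega) 2)
  have hsq : ∀ A : ℕ, A ≤ (A + 1) ^ 2 := fun A => by nlinarith
  set B₁ := (B + 1) ^ 2
  set B₂ := (B₁ + 1) ^ 2
  set B₃ := (B₂ + 1) ^ 2
  have h₁ : B ≤ B₁ := hsq B
  have h₂ : B ≤ B₂ := h₁.trans (hsq B₁)
  refine ⟨(List.range (B₃ + 1)).map fun n => f n.unpair.1 n.unpair.2.unpair.1
    n.unpair.2.unpair.2.unpair.1 n.unpair.2.unpair.2.unpair.2, fun q hq r hr e he m hm => ?_⟩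
  have hlt : Nat.pair q (Nat.pair r (Nat.pair e m)) < B₃ + 1 :=
    Nat.lt_succ_of_le (h h₂ hq (h h₁ hr (h le_rfl he hm)))
  simp [List.getD_eq_getElem?_getD, hlt]

theorem exists_isCertificate [CharZero k] (hη : ∀ g : k, σ g - g ≠ η)
    (hind : ∀ a b : List k, (∃ x ∈ a, x ≠ 0) →
      LinearIndependent (constField σ)
        (fun i : Fin (solve (a, b)).length => toVector b.length ((solve (a, b)).get i)))
    {a : List (List k)} (ha : ∃ p ∈ a, polyOfList p ≠ 0) :
    ∃ c, IsCertificate σ η solve a c := by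
  obtain ⟨N, hN, hlead⟩ := exists_max_coeffAt ha
  obtain ⟨p, hp, hconst, hmem⟩ := exists_const_smul_single_mem (solve := solve) hη hind hN hlead
  simp only [Finsupp.mem_span_range_iff_exists_finsupp] at hmem
  choose l hl using hmem
  -- One number `D` bounds the degree of `p`, the powers of `σ` that occur and the degrees of the
  -- multipliers.
  obtain ⟨D, hpD, hD⟩ : ∃ D, p.natDegree < D ∧
      ∀ q, ∀ t ∈ (l q).support, t.2 < D ∧ (l q t).natDegree < D := by
    refine ⟨p.natDegree + 1 + ∑ q, ∑ t ∈ (l q).support, (t.2 + (l q t).natDegree + 1), by omega,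
      fun q t ht => ?_⟩
    have h₁ := Finset.single_le_sum (f := fun t => t.2 + (l q t).natDegree + 1)
      (fun _ _ => Nat.zero_le _) ht
    have h₂ := Finset.single_le_sum (f := fun q => ∑ t ∈ (l q).support,
      (t.2 + (l q t).natDegree + 1)) (fun _ _ => Nat.zero_le _) (Finset.mem_univ q)
    omega
  have hD₀ : 0 < D := by omega
  set lam : ℕ → ℕ → ℕ → k[X] := fun q r e => if hq : q < (candidates σ η solve a N 0).length then
    if hr : r < a.length + 1 then l ⟨q, hq⟩ (⟨r, hr⟩, e) else 0 else 0 with hlam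
  have hlamD : ∀ q r e, (lam q r e).natDegree < D := fun q r e => by
    simp only [hlam]
    split_ifs with hq hr
    · by_cases h : (⟨r, hr⟩, e) ∈ (l ⟨q, hq⟩).support
      · exact (hD _ _ h).2
      · rw [Finsupp.notMem_support_iff.1 h]
        simpa using hD₀
    · simpa using hD₀
    · simpa using hD₀
  have hid : ∀ q (hq : q < (candidates σ η solve a N 0).length), ∀ i (hi : i < a.length + 1),
      ∀ q' (hq' : q' < (candidates σ η solve a N i).length),
      p * (Pi.single ⟨0, ⟨q, hq⟩⟩ 1 :
        (Σ i : Fin (a.length + 1), Fin (candidates σ η solve a N i).length) → k[X])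
          ⟨⟨i, hi⟩, ⟨q', hq'⟩⟩ =
      ∑ r ∈ Finset.range (a.length + 1), ∑ e ∈ Finset.range D,
        lam q r e * rowPoly σ η solve a N a.length e r i q' := fun q hq i hi q' hq' => by
    have h₁ := hl ⟨q, hq⟩
    rw [Finsupp.sum_of_support_subset (s := Finset.univ ×ˢ Finset.range D) _
      (fun t ht => by simpa using (hD _ t ht).1) _ (by simp), Finset.sum_product] at h₁
    have h₂ := congrFun h₁ ⟨⟨i, hi⟩, ⟨q', hq'⟩⟩
    rw [Pi.smul_apply, smul_eq_mul] at h₂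
    refine h₂.symm.trans ?_
    rw [Finset.sum_range]
    simp only [Finset.sum_apply, Pi.smul_apply, smul_eq_mul, rowVector]
    refine Finset.sum_congr rfl fun r _ => Finset.sum_congr rfl fun e _ => ?_
    simp only [hlam, dif_pos hq, dif_pos r.2]
  obtain ⟨L, hL⟩ := exists_list_getD_pair (fun q r e m => (lam q r e).coeff m)
    ((candidates σ η solve a N 0).length + a.length + 1 + D)
  have hlen : ((List.range (p.natDegree + 1)).map p.coeff).length = p.natDegree + 1 := by simp
  have hgetD : ∀ i < p.natDegree + 1,
      ((List.range (p.natDegree + 1)).map p.coeff).getD i 0 = p.coeff i := fun i hi => by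
    simp [List.getD_eq_getElem?_getD, hi]
  refine ⟨(N, D, (List.range (p.natDegree + 1)).map p.coeff, L), fun i hi m _ => ?_, hlead, ?_, ?_,
    ?_, ?_⟩
  · rcases le_or_gt m N with h | h
    · exact Or.inl h
    · exact Or.inr (hN i hi m h)
  · intro i hi
    rw [hlen] at hi
    rw [hgetD i hi, hconst]
  · intro h
    have := h p.natDegree (by simp)
    rw [hgetD _ (Nat.lt_succ_self _)] at this
    exact hp (leadingCoeff_eq_zero.1 this)
  · rw [hlen]
    exact hpD
  · intro x _ q hq i hi q' hq'
    have h₁ := congrArg (eval (x : k)) (hid q hq i hi q' hq')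
    simp only [eval_finsetSum, eval_mul, eval_rowPoly] at h₁
    have h₂ : evalList (fun m => ((List.range (p.natDegree + 1)).map p.coeff).getD m 0)
        ((List.range (p.natDegree + 1)).map p.coeff).length x = p.eval (x : k) := by
      rw [hlen, evalList, eval_eq_sum_range]
      exact Finset.sum_congr rfl fun i hi => by rw [hgetD i (Finset.mem_range.1 hi)]
    rw [h₂]
    refine Eq.trans ?_ (h₁.trans ?_)
    · split_ifs with h
      · obtain ⟨rfl, rfl⟩ := Nat.pair_eq_pair.1 h
        rw [show (⟨⟨0, hi⟩, ⟨q', hq'⟩⟩ :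
          Σ i : Fin (a.length + 1), Fin (candidates σ η solve a N i).length) =
          ⟨0, ⟨q', hq⟩⟩ from rfl, Pi.single_eq_same]
        simp
      · rw [Pi.single_eq_of_ne]
        · simp
        · intro h'
          refine h (Nat.pair_eq_pair.2 ?_)
          rw [Sigma.mk.injEq] at h'
          obtain ⟨h₃, h₄⟩ := h'
          have h₅ : i = 0 := congrArg Fin.val h₃
          subst h₅
          exact ⟨rfl, congrArg Fin.val (eq_of_heq h₄)⟩
    · refine Finset.sum_congr rfl fun r hr => Finset.sum_congr rfl fun e he => ?_
      have hr' := Finset.mem_range.1 hr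
      have he' : e < D := Finset.mem_range.1 he
      have hq₀ : q < (candidates σ η solve a N 0).length := hq
      congr 1
      rw [← polyOfFun_coeff (hlamD q r e), eval_polyOfFun]
      refine Finset.sum_congr rfl fun m hm => ?_
      have hm' : m < D := Finset.mem_range.1 hm
      dsimp only
      rw [hL q (by omega) r (by omega) e (by omega) m (by omega)]

end Existence

/-! ### Transfer to `k[t]` and the degree bound. -/

section Main

variable {k K : Type*} [Field k] [Field K] [Algebra k K] {σ : k ≃+* k} {τ : K ≃+* K} {t : K} {η : k}

theorem aeval_polyShift (hext : IsDifferenceExtension σ τ) (hη : τ t - t = algebraMap k K η)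
    (y : k[X]) (i : ℕ) : aeval t ((polyShift σ η)^[i] y) = (⇑τ)^[i] (aeval t y) := by
  have h : ∀ y : k[X], aeval t (polyShift σ η y) = τ (aeval t y) := fun y => by
    induction y using Polynomial.induction_on' with
    | add p q hp hq => rw [map_add, map_add, map_add, map_add, hp, hq]
    | monomial n c =>
      rw [← C_mul_X_pow_eq_monomial, map_mul, map_pow, polyShift_C, polyShift_X]
      simp [hext c, ← hη]
  induction i with
  | zero => rfl
  | succ i ih => rw [Function.iterate_succ_apply', h, ih, Function.iterate_succ_apply']

theorem aeval_polyOperator (hext : IsDifferenceExtension σ τ) (hη : τ t - t = algebraMap k K η)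
    (a : List (List k)) (y : k[X]) : aeval t (polyOperator σ η a y) =
      applyOperator τ (a.map fun p => aeval t (polyOfList p)) (aeval t y) := by
  rw [applyOperator_eq_sum_range, polyOperator, map_sum, List.length_map]
  refine Finset.sum_congr rfl fun i hi => ?_
  have := Finset.mem_range.1 hi
  rw [map_mul, aeval_polyShift hext hη]
  simp [List.getD_eq_getElem?_getD, this]

/-- If `σ(g) - g = η`, then `t - g` is a constant of `k(t)`, so it lies in `k` and `t` is algebraic.
-/
theorem IsSigmaStarMonomial.sub_ne (ht : IsSigmaStarMonomial σ τ t)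
    (hext : IsDifferenceExtension σ τ) (hη : τ t - t = algebraMap k K η) (g : k) : σ g - g ≠ η := by
  intro hg
  have h₁ : t - algebraMap k K g ∈
      (IntermediateField.adjoin k {t} : Set K) ∩ (constField τ : Set K) := by
    refine ⟨sub_mem (IntermediateField.mem_adjoin_simple_self k t)
      (IntermediateField.algebraMap_mem _ g), ?_⟩
    change τ (t - algebraMap k K g) = t - algebraMap k K g
    rw [← hg, map_sub] at hη
    rw [map_sub, hext]
    linear_combination hη
  rw [ht.constants] at h₁
  obtain ⟨c, -, hc⟩ := h₁
  have h₂ : t = algebraMap k K (c + g) := by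
    rw [map_add, hc]
    ring
  exact ht.unimonomial.1 (h₂ ▸ isAlgebraic_algebraMap (c + g))

end Main

theorem mainTheorem5 {k K : Type*} [Field k] [CharZero k] [Primcodable k]
    [Field K] [Algebra k K] (σ : k ≃+* k) (τ : K ≃+* K)
    (hcomp : IsComputableDifferenceField σ) (hroots : CanComputeNatRoots σ)
    (hext : IsDifferenceExtension σ τ) (t : K) (ht : IsSigmaStarMonomial σ τ t)
    (hplde : CanSolvePLDE σ) :
    CanBoundPLDEDegree σ τ t := by
  classical
  obtain ⟨η, hη⟩ := ht.shift
  obtain ⟨roots, hrc, hroots⟩ := hroots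
  obtain ⟨solve, hsc, hsolve⟩ := hplde
  have hs : SpansSolutions σ solve := fun a b h => (hsolve a b h).2
  have hη' := ht.sub_ne hext hη
  -- Lists of zero polynomials need not have a certificate; the search accepts anything for them, so
  -- that it terminates on every input.
  have hzero : Computable fun a : List (List k) => decide (∀ i < a.length,
      decide (∀ m < (a.getD i []).length, decide (coeffAt a i m = 0) = true) = true) := by
    open Computable in
    refine decide_forall_lt list_length (decide_forall_lt (list_length.comp
      (list_getD [] fst snd)) (decide_eq (Computable.coeffAt ?_ ?_ snd) (const 0)))
    · exact fst.comp fst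
    · exact snd.comp fst
  obtain ⟨cert, hcc, hcert⟩ := Computable.exists_search
    (p := fun (a : List (List k)) c => decide (∀ i < a.length,
      decide (∀ m < (a.getD i []).length, decide (coeffAt a i m = 0) = true) = true) ||
      decide (IsCertificate σ η solve a c))
    (Computable.bool_or (hzero.comp Computable.fst)
      (hcomp.isCertificate hsc)) fun a => by
      by_cases ha : ∃ p ∈ a, polyOfList p ≠ 0
      · obtain ⟨c, hc⟩ := exists_isCertificate (solve := solve) hη'
          (fun a b h => (hsolve a b h).1) ha
        exact ⟨c, by simp [hc]⟩
      · push Not at ha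
        refine ⟨default, ?_⟩
        rw [Bool.or_eq_true]
        left
        simp only [decide_eq_true_eq]
        intro i hi m _
        rw [coeffAt, ← coeff_polyOfList, ha _ (by simp [List.getD_eq_getElem?_getD, hi]),
          coeff_zero]
  -- The sum of the roots dominates each root, and the sum of the lengths exceeds the degree of
  -- every nonzero `Φ j`. Above this bound the relevant coefficients of the right side vanish, while
  -- `deg y - a.length` would be a root larger than all roots.
  refine ⟨fun x => x.1.length +
    ((∑ i ∈ Finset.range (roots (cert x.1).2.2.1).length, (roots (cert x.1).2.2.1).getD i 0) +
      ∑ i ∈ Finset.range x.2.length, (x.2.getD i []).length), ?_, ?_⟩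
  · open Computable in
    have hadd : Computable₂ fun x y : ℕ => x + y := Primrec.nat_add.to_comp
    have hr : Computable fun x : List (List k) × List (List k) => roots (cert x.1).2.2.1 :=
      hrc.comp (fst.comp (snd.comp (snd.comp (hcc.comp fst))))
    refine nat_add (list_length.comp fst) (nat_add
      (sum_range hadd (list_length.comp hr) (list_getD 0 (hr.comp fst) snd))
      (sum_range hadd (list_length.comp snd) (list_length.comp (list_getD [] ?_ snd))))
    exact snd.comp fst
  · intro a Φ ha y c hy
    have hC : IsCertificate σ η solve a (cert a) := by
      have := hcert a
      simp only [Bool.or_eq_true, decide_eq_true_eq] at this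
      refine this.resolve_left fun h => ?_
      obtain ⟨p, hp, hp₀⟩ := ha
      obtain ⟨i, hi, rfl⟩ := List.mem_iff_getElem.1 hp
      refine hp₀ (Polynomial.ext fun m => ?_)
      have h₁ : a.getD i [] = a[i] := by simp [List.getD_eq_getElem?_getD, hi]
      rw [coeff_polyOfList, coeff_zero]
      rcases lt_or_ge m a[i].length with hm | hm
      · have := h i hi m (by rwa [h₁])
        rwa [coeffAt, h₁] at this
      · exact List.getD_eq_default _ _ hm
    rcases eq_or_ne y 0 with rfl | hy₀
    · simp
    rw [degree_eq_natDegree hy₀, Nat.cast_le]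
    by_contra! hlt
    dsimp only at hlt
    have hpoly : polyOperator σ η a y = ∑ j : Fin Φ.length, C (c j : k) * polyOfList (Φ.get j) := by
      refine (transcendental_iff_injective.1 ht.unimonomial.1) ?_
      rw [aeval_polyOperator hext hη, hy, map_sum]
      simp
    set R := ∑ i ∈ Finset.range (roots (cert a).2.2.1).length, (roots (cert a).2.2.1).getD i 0
    set P := ∑ i ∈ Finset.range Φ.length, (Φ.getD i []).length
    have hroot := hC.eval_eq_zero hs hy₀ (x := y.natDegree - a.length) (by omega) fun r hr => by
      rw [hpoly, finsetSum_coeff]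
      refine Finset.sum_eq_zero fun j _ => ?_
      have h₁ : (Φ.getD j []).length ≤ P := Finset.single_le_sum
        (f := fun i => (Φ.getD i []).length) (fun _ _ => Nat.zero_le _) (Finset.mem_range.2 j.2)
      have h₂ : Φ.getD j [] = Φ.get j := by simp
      rw [h₂] at h₁
      rw [coeff_C_mul, coeff_polyOfList, List.getD_eq_default _ _ (by omega), mul_zero]
    have hp : ∀ x ∈ (cert a).2.2.1, x ∈ constField σ := fun x hx => by
      obtain ⟨i, hi, rfl⟩ := List.mem_iff_getElem.1 hx
      have := hC.const i hi
      rwa [List.getD_eq_getElem _ _ hi] at this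
    have hp₀ : polyOfList (cert a).2.2.1 ≠ 0 := fun h => hC.ne_zero fun i _ => by
      rw [← coeff_polyOfList, h, coeff_zero]
    have hmem := (hroots _ hp hp₀ _).2 hroot
    obtain ⟨i, hi, hi'⟩ := List.mem_iff_getElem.1 hmem
    have hle : (roots (cert a).2.2.1).getD i 0 ≤ R := Finset.single_le_sum
      (f := fun i => (roots (cert a).2.2.1).getD i 0) (fun _ _ => Nat.zero_le _)
      (Finset.mem_range.2 hi)
    rw [List.getD_eq_getElem _ _ hi, hi'] at hle
    omega
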